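/- Throughout, $\mathbb N=\{1,2,3,\dots\}$ and $\mathbb T=\{(k,m,n)\in\mathbb N^3 : m\ge k\}$. For $f,g\colon\mathbb T\to[0,\infty]$ write $f\preccurlyeq g$ if there is $C\in\mathbb N$ such that $$f(k,Cm,n)\le C\,g(Ck,m,Cn)+C\,\frac nm+C$$ for all $(k,m,n)\in\mathbb N^3$ with $m\ge Ck$, and write $f\sim g$ if $f\preccurlyeq g$ and $g\preccurlyeq f$. A function on $\mathbb T$ is *finitary* if all its values are finite. *Groups.* Let $G$ be a group generated by a finite set $X$. Let $\mathcal S_k\subseteq F(X)$ be the set of elements given by words of length at most $k$ in $X\cup X^{-1}$ that represent $1$ in $G$, let $\langle\langle\mathcal S_k\rangle\rangle$ be its normal closure, and let $\mathrm{Area}_{\mathcal S_m}(w)$ be the least $\ell$ such that $w=\prod_{i=1}^{\ell}f_i^{-1}R_i^{\pm1}f_i$ with $f_i\in F(X)$, $R_i\in\mathcal S_m$. The isoperimetric spectrum of $G$ with respect to $X$ is $$f_{G,X}(k,m,n)=\sup\{\mathrm{Area}_{\mathcal S_m}(w) : w\in\langle\langle\mathcal S_k\rangle\rangle,\ \|w\|\le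 n\}.$$ *Graphs.* Graphs may have loops and multiple edges, and are metric spaces with edges identified with $[0,1]$. A combinatorial $k$-filling of a combinatorial loop $c$ in a graph $\Gamma$ is a map $\phi\colon D\to\Gamma$ from a finite connected plane graph $D$ that sends vertices to vertices and each edge to an edge or a vertex, sends the exterior boundary path of $D$ (from a suitable starting vertex) to the path $c$, and sends the boundary path of every interior face to a loop of length at most $k$; its area is the number of interior faces of $D$. Let $C_k(\Gamma)$ be the set of loops admitting a $k$-filling, and for $c\in C_k(\Gamma)$ let $\mathrm{Area}_k(c)$ be the minimal area of a $k$-filling of $c$. The isoperimetric spectrum of $\Gamma$ is $$f_\Gamma(k,m,n)=\sup\{\mathrm{Area}_m(c) : c\in C_k(\Gamma),\ \ell(c)\le n\}\in[0,\infty].$$ **Theorem.** 1. Let $G$ and $H$ be groups generated by finite sets $X$ and $Y$, respectively. If $G$ and $H$ are quasi-isometric, then $f_{G,X}$ and $f_{H,Y}$ are finitary and $f_{G,X}\sim f_{H,Y}$. 2. In particular, if $X$ and $Y$ are finite generating sets of the same group $G$, then $f_{G,X}\sim f_{G,Y}$. 3. Let $\Gamma$ and $\Delta$ be connected quasi-isometric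 graphs. Then $f_\Gamma\sim f_\Delta$. If, moreover, $f_\Gamma$ is finitary, then there is $C\in\mathbb N$ such that $f_\Delta(k,m,n)<\infty$ for all $(k,m,n)\in\mathbb N^3$ with $m\ge Ck$. -/

import Mathlib

open scoped ENNReal

universe u v u' v'

namespace IsoSpec

/-! ### Quasi-isometries and the order on spectra -/

/-- Quasi-isometry of two sets with distance functions: there are `L ≥ 0` and two `(L, L)`-coarsely
Lipschitz maps which are `L`-coarse inverses of each other. -/
def QuasiIsometric {S : Type u} {T : Type v} (dS : S → S → ℝ) (dT : T → T → ℝ) : Prop :=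
  ∃ L : ℝ, 0 ≤ L ∧ ∃ (α : S → T) (β : T → S),
    (∀ x y, dT (α x) (α y) ≤ L * dS x y + L) ∧
    (∀ x y, dS (β x) (β y) ≤ L * dT x y + L) ∧
    (∀ t, dT (α (β t)) t ≤ L) ∧
    (∀ s, dS (β (α s)) s ≤ L)

/-- `f ≼ g`: there is a positive integer `C` with
`f(k, Cm, n) ≤ C g(Ck, m, Cn) + C n/m + C` for all positive `k, m, n` with `m ≥ Ck`.
Only values at triples `(k, m, n)` of positive integers with `m ≥ k` are used. Values lie
in `[0, ∞]`; for finite values this is the usual inequality of real numbers. -/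
def Preceq (f g : ℕ → ℕ → ℕ → ℝ≥0∞) : Prop :=
  ∃ C : ℕ, 1 ≤ C ∧ ∀ k m n : ℕ, 1 ≤ k → 1 ≤ m → 1 ≤ n → C * k ≤ m →
    f k (C * m) n ≤ C * g (C * k) m (C * n) + C * ((n : ℝ≥0∞) / (m : ℝ≥0∞)) + C

/-- `f ∼ g`: both `f ≼ g` and `g ≼ f`. -/
def Equivalent (f g : ℕ → ℕ → ℕ → ℝ≥0∞) : Prop :=
  Preceq f g ∧ Preceq g f

/-- All values at triples of positive integers `(k, m, n)` with `m ≥ k` are finite. -/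
def Finitary (f : ℕ → ℕ → ℕ → ℝ≥0∞) : Prop :=
  ∀ k m n : ℕ, 1 ≤ k → 1 ≤ n → k ≤ m → f k m n ≠ ⊤

/-! ### Groups -/

section Groups

variable {G : Type u} [Group G]

/-- The element of `G` represented by an element of the free group `F(X)`. -/
def evalHom (X : Set G) : FreeGroup X →* G :=
  FreeGroup.lift (fun x : X => (x : G))

/-- The word metric of `G` with respect to `X`: the least length of a word in `X ∪ X⁻¹`
representing `g⁻¹ h`. (When `X` generates `G`, such words exist.) -/
noncomputable def wordDist (X : Set G) (g h : G) : ℕ :=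
  sInf {n | ∃ w : List (X × Bool), evalHom X (FreeGroup.mk w) = g⁻¹ * h ∧ w.length = n}

/-- The elements of the free group given by words of length at most `k` in `X ∪ X⁻¹`
representing `1` in `G`. -/
def relators (X : Set G) (k : ℕ) : Set (FreeGroup X) :=
  {r | ∃ w : List (X × Bool), FreeGroup.mk w = r ∧ w.length ≤ k ∧ evalHom X r = 1}

/-- The least number of factors in a decomposition of `w` as a product of elements
`f⁻¹ R^{±1} f` with `R ∈ S`; it is `⊤` if and only if there is no such decomposition. -/
noncomputable def wordArea {F : Type u} [Group F] (S : Set F) (w : F) : ℕ∞ :=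
  ⨅ (l : List F) (_ : l.prod = w)
    (_ : ∀ x ∈ l, ∃ f : F, ∃ R ∈ S, x = f⁻¹ * R * f ∨ x = f⁻¹ * R⁻¹ * f), (l.length : ℕ∞)

/-- The isoperimetric spectrum of `G` with respect to `X`: the supremum of the areas, with respect
to relators of length at most `m`, of all words of length at most `n` which lie in the
normal closure of the relators of length at most `k`. -/
noncomputable def groupSpectrum (X : Set G) (k m n : ℕ) : ℝ≥0∞ :=
  ((⨆ (w : List (X × Bool)) (_ : w.length ≤ n)
    (_ : FreeGroup.mk w ∈ Subgroup.normalClosure (relators X k)),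
      wordArea (relators X m) (FreeGroup.mk w) : ℕ∞) : ℝ≥0∞)

end Groups

/-- Two groups are quasi-isometric if they are so for the word metrics of some finite
generating sets. -/
def GroupsQuasiIsometric (G : Type u) (H : Type v) [Group G] [Group H] : Prop :=
  ∃ (X : Set G) (Y : Set H), X.Finite ∧ Subgroup.closure X = ⊤ ∧
    Y.Finite ∧ Subgroup.closure Y = ⊤ ∧
    QuasiIsometric (fun g h => (wordDist X g h : ℝ)) (fun g h => (wordDist Y g h : ℝ))

/-! ### Graphs -/

/-- A graph, multiple edges and loops allowed, with vertex set `V`. The elements of `A` are the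
oriented edges; each edge gives two of them, interchanged by `inv`. -/
structure DartGraph (V : Type u) (A : Type v) where
  org : A → V
  inv : A → A
  inv_inv : ∀ a, inv (inv a) = a
  inv_ne : ∀ a, inv a ≠ a

namespace DartGraph

variable {V : Type u} {A : Type v} (Γ : DartGraph V A)

/-- The terminal vertex of an oriented edge. -/
def term (a : A) : V := Γ.org (Γ.inv a)

/-- `l` is the sequence of oriented edges of a path from the first to the second vertex. -/
def IsPath : V → List A → V → Prop
  | p, [], q => p = q
  | p, a :: l, q => Γ.org a = p ∧ IsPath (Γ.term a) l q

/-- A connected (in particular, nonempty) graph. -/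
def Connected : Prop :=
  Nonempty V ∧ ∀ p q : V, ∃ l : List A, Γ.IsPath p l q

/-- A (combinatorial) loop. The length is the length of the list of edges. -/
structure Loop where
  base : V
  edges : List A
  isPath : Γ.IsPath base edges base

/-- The combinatorial distance between two vertices (of a connected graph). -/
noncomputable def vertexDist (p q : V) : ℕ :=
  sInf {n | ∃ l : List A, Γ.IsPath p l q ∧ l.length = n}

/-- Points of the geometric realization: vertices, and the points `(a, t)` at distance `t` from
the origin along the oriented edge `a`. A point may have several such names; different names
of one point have distance `0` below. -/
abbrev Point (_ : DartGraph V A) : Type (max u v) := V ⊕ (A × unitInterval)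

/-- The ends of the edge on which a point lies, with the distance to them along the edge. -/
def exits : Γ.Point → Set (V × ℝ)
  | Sum.inl p => {(p, 0)}
  | Sum.inr (a, t) => {(Γ.org a, (t : ℝ)), (Γ.term a, 1 - (t : ℝ))}

/-- Lengths of the candidates for a shortest arc between two points: through vertices, or inside
a single edge. -/
def arcLengths (x y : Γ.Point) : Set ℝ :=
  {r | ∃ e ∈ Γ.exits x, ∃ f ∈ Γ.exits y, r = e.2 + (Γ.vertexDist e.1 f.1 : ℝ) + f.2} ∪
  {r | ∃ (a : A) (s t : unitInterval), x = Sum.inr (a, s) ∧ y = Sum.inr (a, t) ∧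
    r = |(s : ℝ) - (t : ℝ)|} ∪
  {r | ∃ (a : A) (s t : unitInterval), x = Sum.inr (a, s) ∧ y = Sum.inr (Γ.inv a, t) ∧
    r = |(s : ℝ) - (1 - (t : ℝ))|}

/-- The length metric on the realization of a connected graph, edges being identified
with `[0, 1]`. -/
noncomputable def realDist (x y : Γ.Point) : ℝ := sInf (Γ.arcLengths x y)

end DartGraph

/-- A generalized combinatorial map of graphs: vertices go to vertices, and every edge goes to an
edge (`some b`) or is collapsed to a vertex (`none`). -/
structure GenMap {V : Type u} {A : Type v} {W : Type u'} {B : Type v'}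
    (D : DartGraph V A) (Γ : DartGraph W B) where
  onV : V → W
  onA : A → Option B
  map_inv : ∀ a, onA (D.inv a) = (onA a).map Γ.inv
  map_org : ∀ a b, onA a = some b → Γ.org b = onV (D.org a)
  map_collapsed : ∀ a, onA a = none → onV (D.org a) = onV (D.term a)

/-- The image of a path: collapsed edges do not contribute. -/
def GenMap.mapPath {V : Type u} {A : Type v} {W : Type u'} {B : Type v'}
    {D : DartGraph V A} {Γ : DartGraph W B} (φ : GenMap D Γ) (l : List A) : List B :=
  l.filterMap φ.onA

/-! ### Plane graphs, as rotation systems of genus zero with a chosen exterior face -/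

/-- A graph with a rotation system: `rot` sends an oriented edge to the next one in the cyclic order
around its origin. -/
structure RotationGraph (V : Type u) (A : Type v) extends DartGraph V A where
  rot : Equiv.Perm A
  sameCycle_rot : ∀ a b, rot.SameCycle a b ↔ org a = org b

namespace RotationGraph

variable {V : Type u} {A : Type v} (D : RotationGraph V A)

/-- The next oriented edge after `a` on the boundary of the face lying on a fixed side of `a`. -/
def next (a : A) : A := D.rot (D.inv a)

/-- The boundary path of the face at `a`, starting with `a`: `a, next a, next (next a), …` up to
the first return to `a`. -/
noncomputable def boundary (a : A) : List A :=
  (List.range (Function.minimalPeriod D.next a)).map (fun i => D.next^[i] a)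

/-- The face at `a`, as the set of oriented edges on its boundary path. -/
def face (a : A) : Set A := {b | b ∈ D.boundary a}

end RotationGraph

/-- A finite connected plane graph, up to orientation preserving homeomorphism of the plane:
a finite connected graph with a rotation system satisfying Euler's formula
`#V - #E + #F = 2`, and one face chosen as exterior. (A graph without edges has the exterior face
only, with empty boundary; then `exterior = ∅`.) -/
structure PlaneGraph where
  V : Type
  A : Type
  finite_V : Finite V
  finite_A : Finite A
  graph : RotationGraph V A
  connected : graph.toDartGraph.Connected
  exterior : Set A
  exterior_face : Nonempty A → ∃ a, exterior = graph.face a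
  /-- Euler's formula, multiplied by two; the number of oriented edges is `2 #E`, and there is one
  face in addition to the interior ones. -/
  euler : 2 * Nat.card V + 2 * ((Set.range graph.face \ {exterior}).ncard + 1) = Nat.card A + 4

/-- The number of interior faces. -/
noncomputable def PlaneGraph.area (D : PlaneGraph) : ℕ :=
  (Set.range D.graph.face \ {D.exterior}).ncard

namespace DartGraph

variable {V : Type u} {A : Type v} (Γ : DartGraph V A)

/-- `φ : D → Γ` is a combinatorial `k`-filling of the loop `c`: the exterior boundary path, read
from a suitable place, is sent to `c`, and the boundary path of every interior face is sent to a
loop of length at most `k`. -/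
def IsFilling (k : ℕ) (c : Γ.Loop) (D : PlaneGraph) (φ : GenMap D.graph.toDartGraph Γ) : Prop :=
  ((∃ a ∈ D.exterior, φ.onV (D.graph.org a) = c.base ∧
      φ.mapPath (D.graph.boundary a) = c.edges) ∨
    (IsEmpty D.A ∧ (∃ o, φ.onV o = c.base) ∧ c.edges = [])) ∧
  ∀ a, a ∉ D.exterior → (φ.mapPath (D.graph.boundary a)).length ≤ k

/-- The loop `c` is `k`-contractible. -/
def Contractible (k : ℕ) (c : Γ.Loop) : Prop :=
  ∃ (D : PlaneGraph) (φ : GenMap D.graph.toDartGraph Γ), Γ.IsFilling k c D φ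

/-- The minimal area of a combinatorial `k`-filling of `c` (`⊤` if `c` is not `k`-contractible). -/
noncomputable def loopArea (k : ℕ) (c : Γ.Loop) : ℕ∞ :=
  ⨅ (D : PlaneGraph) (φ : GenMap D.graph.toDartGraph Γ) (_ : Γ.IsFilling k c D φ), (D.area : ℕ∞)

/-- The isoperimetric spectrum of a graph. -/
noncomputable def spectrum (k m n : ℕ) : ℝ≥0∞ :=
  ((⨆ (c : Γ.Loop) (_ : Γ.Contractible k c) (_ : c.edges.length ≤ n), Γ.loopArea m c : ℕ∞) : ℝ≥0∞)

end DartGraph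

end IsoSpec

/-!
The invariance of isoperimetric spectra under quasi-isometries follows the classical pattern for
Dehn functions, with attention to the length `m` of the faces. Let `α` and `β` be coarsely inverse
maps. A loop `c` with a `k`-filling is mapped by `α` to a loop with a `Ck`-filling, since every edge
becomes a path of bounded length. An optimal `m`-filling of the image is mapped back by `β` to a
`Cm`-filling of a loop close to `c`, and the thin annulus between this loop and `c` is cut into
at most `n / m + 2` faces, one for every `m` edges of `c`. Thus
`f(k, Cm, n) ≤ g(Ck, m, Cn) + n / m + 2` (`preceq_of_le`).

For groups no plane graphs are needed. A map `α : G → H` induces a cocycle on the free group with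
values in another one (`exists_isCocycle`, a homomorphism to a semidirect product), which
describes the images of paths in the Cayley graph. Cocycles carry products of `ℓ` conjugates of
relators to such products (`IsCocycle.areaLE`), and `IsCocycle.areaLE_of_close` is the annulus.
Spectra are finitary because there are only finitely many words of a given length.

For graphs the constructions take place in plane graphs, given as rotation systems with Euler's
formula. Three surgeries suffice: attaching a spike (`Diagram.spike`), adding a chord in the
exterior face (`Diagram.chord`) and subdividing an edge (`Diagram.subdivide`). They are carried out
for a `Diagram`, in which edges are labelled by paths of arbitrary length. Hence mapping a
diagram to another graph is only a change of labels (`Fills.map`); subdivision makes all labels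
short again (`Diagram.exists_refined`), so that diagrams and fillings are equivalent
(`DartGraph.IsFilling.fills` and `Fills.exists_isFilling`). The annulus is built chord by chord in
`DartGraph.fills_of_close`. A quasi-isometry of the realizations is first replaced by
maps of the vertex sets (`DartGraph.nearVertex`).
-/

namespace IsoSpec

/-! ### Orbits of permutations -/

/-- An equivalence relation relating every point to its image contains the orbit relation. -/
theorem rel_of_sameCycle {A : Type*} {σ : Equiv.Perm A} {r : A → A → Prop}
    (hr : _root_.Equivalence r) (h : ∀ x, r x (σ x)) {x y : A} (hxy : σ.SameCycle x y) : r x y := by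
  have hn : ∀ (n : ℕ) (x : A), r x ((σ ^ n) x) := by
    intro n
    induction n with
    | zero => intro x; exact hr.refl x
    | succ n ih => intro x; rw [pow_succ']; exact hr.trans (ih x) (h _)
  obtain ⟨i, rfl⟩ := hxy
  obtain ⟨n, rfl | rfl⟩ := i.eq_nat_or_neg
  · simpa using hn n x
  · have := hn n ((σ ^ (-(n : ℤ))) x)
    rw [← Equiv.Perm.mul_apply, ← zpow_natCast, ← zpow_add] at this
    simpa using hr.symm this

theorem sameCycle_map {A A' : Type*} {σ : Equiv.Perm A} {σ' : Equiv.Perm A'} (ι : A → A')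
    (h : ∀ x, σ'.SameCycle (ι x) (ι (σ x))) {x y : A} (hxy : σ.SameCycle x y) :
    σ'.SameCycle (ι x) (ι y) :=
  rel_of_sameCycle (r := fun x y => σ'.SameCycle (ι x) (ι y))
    ⟨fun _ => .refl _ _, fun h => h.symm, fun h h' => h.trans h'⟩ h hxy

theorem eq_of_sameCycle {A X : Type*} {σ : Equiv.Perm A} (f : A → X) (h : ∀ x, f (σ x) = f x)
    {x y : A} (hxy : σ.SameCycle x y) : f x = f y :=
  rel_of_sameCycle (r := fun x y => f x = f y)
    ⟨fun _ => rfl, fun h => h.symm, fun h h' => h.trans h'⟩ (fun x => (h x).symm) hxy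

/-- `Run σ a l b`: the list `l` consists of the successive iterates of `a` under `σ`, up to but not
including `b`. -/
def Run {A : Type*} (σ : A → A) : A → List A → A → Prop
  | a, [], b => a = b
  | a, x :: l, b => x = a ∧ Run σ (σ a) l b

section Run

variable {A A' : Type*} {σ : A → A} {σ' : A' → A'}

theorem run_append {l l' : List A} {a b : A} :
    Run σ a (l ++ l') b ↔ ∃ c, Run σ a l c ∧ Run σ c l' b := by
  induction l generalizing a with
  | nil => simp [Run]
  | cons x l ih => simp [Run, ih, and_assoc]

theorem Run.apply_mem {l : List A} {a b x : A} (h : Run σ a l b) (hx : x ∈ l) :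
    σ x ∈ l.tail ∨ σ x = b := by
  induction l generalizing a with
  | nil => simp at hx
  | cons y l ih =>
    obtain ⟨rfl, h⟩ := h
    rcases List.mem_cons.1 hx with rfl | hx
    · cases l with
      | nil => exact Or.inr h
      | cons z l => left; simp [h.1]
    · rcases ih h hx with h' | h'
      · exact Or.inl (List.mem_of_mem_tail h')
      · exact Or.inr h'

theorem Run.exists_pred {l : List A} {a b y : A} (h : Run σ a l b) (hy : y ∈ l) :
    y = a ∨ ∃ x ∈ l, σ x = y := by
  induction l generalizing a with
  | nil => simp at hy
  | cons z l ih =>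
    obtain ⟨rfl, h⟩ := h
    rcases List.mem_cons.1 hy with rfl | hy
    · exact Or.inl rfl
    · rcases ih h hy with rfl | ⟨x, hx, rfl⟩
      · exact Or.inr ⟨z, by simp, rfl⟩
      · exact Or.inr ⟨x, by simp [hx], rfl⟩

theorem Run.exists_last {l : List A} {a b : A} (h : Run σ a l b) (hl : l ≠ []) :
    ∃ x ∈ l, σ x = b := by
  induction l generalizing a with
  | nil => simp at hl
  | cons z l ih =>
    obtain ⟨rfl, h⟩ := h
    cases l with
    | nil => exact ⟨z, by simp, h⟩
    | cons y l =>
      obtain ⟨x, hx, hb⟩ := ih h (by simp)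
      exact ⟨x, List.mem_cons_of_mem _ hx, hb⟩

theorem Run.start_mem {l : List A} {a b : A} (h : Run σ a l b) (hl : l ≠ []) : a ∈ l := by
  cases l with
  | nil => simp at hl
  | cons z l => simp [h.1]

theorem Run.sameCycle {σ : Equiv.Perm A} {l : List A} {a b x : A} (h : Run σ a l b)
    (hx : x ∈ l) : σ.SameCycle a x := by
  induction l generalizing a with
  | nil => simp at hx
  | cons y l ih =>
    obtain ⟨rfl, h⟩ := h
    rcases List.mem_cons.1 hx with rfl | hx
    · exact .refl _ _
    · exact Equiv.Perm.sameCycle_apply_left.1 (ih h hx)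

/-- Transport of a run along an injection `ι`, the last step being redirected to `z`. -/
theorem Run.map (ι : A → A') {l : List A} {a b : A} {z : A'} (h : Run σ a l b) (hl : l ≠ [])
    (h₁ : ∀ x ∈ l, σ x ∈ l.tail → σ' (ι x) = ι (σ x))
    (h₂ : ∀ x ∈ l, σ x = b → σ' (ι x) = z) : Run σ' (ι a) (l.map ι) z := by
  induction l generalizing a with
  | nil => simp at hl
  | cons y l ih =>
    obtain ⟨rfl, h⟩ := h
    refine ⟨rfl, ?_⟩
    cases l with
    | nil => exact h₂ y (by simp) h
    | cons x l =>
      have hx : x = σ y := h.1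
      rw [h₁ y (by simp) (by simp [hx])]
      refine ih h (by simp) (fun w hw hw' => h₁ w (by simp [List.mem_cons.1 hw]) ?_)
        (fun w hw => h₂ w (by simp [List.mem_cons.1 hw]))
      exact List.mem_of_mem_tail hw'

theorem Run.flatMap (ι : A → A') (E : A → List A') {l : List A} {a b : A} (h : Run σ a l b)
    (hE : ∀ x, Run σ' (ι x) (E x) (ι (σ x))) : Run σ' (ι a) (l.flatMap E) (ι b) := by
  induction l generalizing a with
  | nil => exact congrArg ι h
  | cons y l ih =>
    obtain ⟨rfl, h⟩ := h
    exact run_append.2 ⟨_, hE y, ih h⟩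

theorem Run.eq_map_range {l : List A} {a b : A} (h : Run σ a l b) :
    l = (List.range l.length).map (fun i => σ^[i] a) ∧ σ^[l.length] a = b := by
  induction l generalizing a with
  | nil => exact ⟨rfl, h⟩
  | cons y l ih =>
    obtain ⟨rfl, h⟩ := h
    obtain ⟨h₁, h₂⟩ := ih h
    refine ⟨?_, h₂⟩
    rw [List.length_cons, List.range_succ_eq_map, List.map_cons, List.map_map]
    exact congrArg _ h₁

theorem run_map_range (σ : A → A) (a : A) (n : ℕ) :
    Run σ a ((List.range n).map (fun i => σ^[i] a)) (σ^[n] a) := by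
  induction n with
  | zero => rfl
  | succ n ih =>
    rw [List.range_succ, List.map_append]
    refine run_append.2 ⟨_, ih, rfl, ?_⟩
    exact (Function.iterate_succ_apply' σ n a).symm

end Run

/-! ### Paths in graphs -/

namespace DartGraph

variable {V : Type u} {A : Type v} {W : Type u'} {B : Type v'} (Γ : DartGraph V A)

@[simp] theorem term_inv (a : A) : Γ.term (Γ.inv a) = Γ.org a := by
  simp [term, Γ.inv_inv]

theorem inv_injective : Function.Injective Γ.inv :=
  Function.LeftInverse.injective Γ.inv_inv

/-- The inverse of a path. -/
def rev (l : List A) : List A := (l.map Γ.inv).reverse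

@[simp] theorem rev_nil : Γ.rev [] = [] := rfl

@[simp] theorem rev_rev (l : List A) : Γ.rev (Γ.rev l) = l := by
  simp [rev, Function.comp_def, Γ.inv_inv]

@[simp] theorem length_rev (l : List A) : (Γ.rev l).length = l.length := by simp [rev]

@[simp] theorem rev_append (l l' : List A) : Γ.rev (l ++ l') = Γ.rev l' ++ Γ.rev l := by
  simp [rev]

variable {Γ}

theorem isPath_append {l l' : List A} {p q : V} :
    Γ.IsPath p (l ++ l') q ↔ ∃ r, Γ.IsPath p l r ∧ Γ.IsPath r l' q := by
  induction l generalizing p with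
  | nil => simp [IsPath]
  | cons x l ih => simp [IsPath, ih, and_assoc]

theorem IsPath.rev {l : List A} {p q : V} (h : Γ.IsPath p l q) : Γ.IsPath q (Γ.rev l) p := by
  induction l generalizing p with
  | nil => exact h.symm
  | cons x l ih =>
    rw [← List.singleton_append, Γ.rev_append]
    exact isPath_append.2 ⟨_, ih h.2, rfl, (Γ.term_inv x).trans h.1⟩

theorem IsPath.unique {l : List A} {p q q' : V} (h : Γ.IsPath p l q) (h' : Γ.IsPath p l q') :
    q = q' := by
  induction l generalizing p with
  | nil => exact h.symm.trans h'
  | cons x l ih => exact ih h.2 h'.2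

/-- Substituting paths for the edges of a path gives a path. -/
theorem IsPath.flatMap {Δ : DartGraph W B} (α : V → W) {P : A → List B}
    (hP : ∀ a, Δ.IsPath (α (Γ.org a)) (P a) (α (Γ.term a))) {l : List A} {p q : V}
    (h : Γ.IsPath p l q) : Δ.IsPath (α p) (l.flatMap P) (α q) := by
  induction l generalizing p with
  | nil => exact congrArg α h
  | cons x l ih =>
    obtain ⟨rfl, h⟩ := h
    exact isPath_append.2 ⟨_, hP x, ih h⟩

theorem flatMap_rev {Δ : DartGraph W B} {P : A → List B}
    (hP : ∀ a, P (Γ.inv a) = Δ.rev (P a)) (l : List A) :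
    (Γ.rev l).flatMap P = Δ.rev (l.flatMap P) := by
  induction l with
  | nil => rfl
  | cons x l ih =>
    rw [← List.singleton_append, Γ.rev_append, List.flatMap_append, ih]
    simpa [DartGraph.rev] using hP x

/-- If all adjacent vertices of `Γ` are joined in `Δ`, so are all vertices joined in `Γ`. -/
theorem exists_isPath_map {Δ : DartGraph W B} (α : V → W)
    (hP : ∀ a, ∃ l, Δ.IsPath (α (Γ.org a)) l (α (Γ.term a))) {l : List A} {p q : V}
    (h : Γ.IsPath p l q) : ∃ l', Δ.IsPath (α p) l' (α q) := by
  choose P hP using hP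
  exact ⟨_, h.flatMap α hP⟩

theorem length_flatMap_le {P : A → List B} {N : ℕ} (hP : ∀ a, (P a).length ≤ N) (l : List A) :
    (l.flatMap P).length ≤ N * l.length := by
  induction l with
  | nil => simp
  | cons x l ih =>
    have := hP x
    simp only [List.flatMap_cons, List.length_append, List.length_cons]
    nlinarith

/-- A criterion for connectedness: every vertex is joined to a fixed one. -/
theorem connected_of_base (o : V) (h : ∀ q, ∃ l, Γ.IsPath o l q) : Γ.Connected := by
  refine ⟨⟨o⟩, fun p q => ?_⟩
  obtain ⟨l, hl⟩ := h p
  obtain ⟨l', hl'⟩ := h q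
  exact ⟨_, isPath_append.2 ⟨_, hl.rev, hl'⟩⟩

end DartGraph

namespace RotationGraph

variable {V : Type u} {A : Type v} (D : RotationGraph V A)

/-- The map `next`, as a permutation of the oriented edges; its orbits are the faces. -/
def nextPerm : Equiv.Perm A :=
  (Function.Involutive.toPerm D.inv D.inv_inv).trans D.rot

@[simp] theorem nextPerm_apply (a : A) : D.nextPerm a = D.next a := rfl

theorem coe_nextPerm : (D.nextPerm : A → A) = D.next := rfl

theorem next_injective : Function.Injective D.next := D.nextPerm.injective

theorem org_rot (a : A) : D.org (D.rot a) = D.org a :=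
  ((D.sameCycle_rot _ _).1 (Equiv.Perm.sameCycle_apply_right.2 (.refl _ _))).symm

theorem org_next (a : A) : D.org (D.next a) = D.term a := D.org_rot _

end RotationGraph

/-! ### Disc diagrams -/

/-- A disc diagram over `Γ`: a finite connected plane graph with at least one edge, whose oriented
edges are labelled by paths (of any length, possibly empty) in `Γ`. In contrast to the
definition of a `PlaneGraph`, the faces form a type `F` of their own, `faceOf a` being the face with
`a` on its boundary path. The exterior face is the one at `start`, and `outer` is its
boundary path starting there. -/
structure Diagram {W : Type u'} {B : Type v'} (Γ : DartGraph W B) where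
  V : Type
  A : Type
  F : Type
  [fintypeV : Fintype V]
  [fintypeA : Fintype A]
  [fintypeF : Fintype F]
  graph : RotationGraph V A
  connected : graph.toDartGraph.Connected
  faceOf : A → F
  faceOf_surjective : Function.Surjective faceOf
  sameCycle_next : ∀ a b, graph.nextPerm.SameCycle a b ↔ faceOf a = faceOf b
  euler : 2 * Fintype.card V + 2 * Fintype.card F = Fintype.card A + 4
  onV : V → W
  label : A → List B
  isPath_label : ∀ a, Γ.IsPath (onV (graph.org a)) (label a) (onV (graph.term a))
  label_inv : ∀ a, label (graph.inv a) = Γ.rev (label a)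
  start : A
  outer : List A
  run_outer : Run graph.next start outer start
  nodup_outer : outer.Nodup
  mem_outer : ∀ x, x ∈ outer ↔ faceOf x = faceOf start

attribute [instance] Diagram.fintypeV Diagram.fintypeA Diagram.fintypeF

namespace Diagram

variable {W : Type u'} {B : Type v'} {Γ : DartGraph W B}

/-- The vertex of `Γ` at which the boundary loop of a diagram is based. -/
def base (M : Diagram Γ) : W := M.onV (M.graph.org M.start)

/-- The label of the exterior boundary path. -/
def word (M : Diagram Γ) : List B := M.outer.flatMap M.label

open Classical in
/-- The length of the label of the boundary path of a face. -/
noncomputable def perimeter (M : Diagram Γ) (f : M.F) : ℕ :=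
  ∑ a, if M.faceOf a = f then (M.label a).length else 0

theorem start_mem (M : Diagram Γ) : M.start ∈ M.outer := (M.mem_outer _).2 rfl

theorem outer_ne_nil (M : Diagram Γ) : M.outer ≠ [] := List.ne_nil_of_mem M.start_mem

theorem faceOf_next (M : Diagram Γ) (a : M.A) : M.faceOf (M.graph.next a) = M.faceOf a :=
  ((M.sameCycle_next _ _).1 (Equiv.Perm.sameCycle_apply_right.2 (.refl _ _))).symm

theorem isPath_flatMap_label (M : Diagram Γ) {l : List M.A} {a b : M.A}
    (h : Run M.graph.next a l b) :
    Γ.IsPath (M.onV (M.graph.org a)) (l.flatMap M.label) (M.onV (M.graph.org b)) := by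
  induction l generalizing a with
  | nil => rw [show a = b from h]; rfl
  | cons x l ih =>
    obtain ⟨rfl, h⟩ := h
    refine DartGraph.isPath_append.2 ⟨_, M.isPath_label x, ?_⟩
    rw [← M.graph.org_next]
    exact ih h

end Diagram

/-! ### Attaching a spike to a diagram -/

namespace Diagram

variable {W : Type u'} {B : Type v'} {Γ : DartGraph W B}

/-- The diagram with one edge and two vertices, mapped to a single vertex of `Γ`. -/
def trivial (Γ : DartGraph W B) (p : W) : Diagram Γ where
  V := Bool
  A := Bool
  F := Unit
  graph :=
    { org := id
      inv := not
      inv_inv := by decide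
      inv_ne := by decide
      rot := 1
      sameCycle_rot := by simp }
  connected := by
    refine DartGraph.connected_of_base true fun q => ?_
    cases q
    · exact ⟨[true], rfl, rfl⟩
    · exact ⟨[], rfl⟩
  faceOf _ := ()
  faceOf_surjective _ := ⟨true, rfl⟩
  sameCycle_next a b := by
    refine iff_of_true ?_ rfl
    by_cases h : a = b
    · exact h ▸ .refl _ _
    · refine ⟨1, ?_⟩
      cases a <;> cases b <;> first | exact absurd rfl h | rfl
  euler := by simp
  onV _ := p
  label _ := []
  isPath_label _ := rfl
  label_inv _ := rfl
  start := true
  outer := [true, false]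
  run_outer := ⟨rfl, rfl, rfl⟩
  nodup_outer := by decide
  mem_outer := by decide

/-- The same diagram, its exterior boundary being read from another place. -/
def rotate (M : Diagram Γ) {l l' : List M.A} {b : M.A} (h : M.outer = l ++ l')
    (hl : Run M.graph.next M.start l b) (hl' : Run M.graph.next b l' M.start)
    (hb : b ∈ M.outer) : Diagram Γ where
  __ := M
  start := b
  outer := l' ++ l
  run_outer := run_append.2 ⟨_, hl', hl⟩
  nodup_outer := List.nodup_append_comm.1 (h ▸ M.nodup_outer)
  mem_outer x := by
    rw [(M.mem_outer b).1 hb, ← M.mem_outer, h, List.mem_append, List.mem_append, or_comm]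

section Spike

variable (M : Diagram Γ)

open Classical in
/-- Attaching an edge with a new end vertex at the origin of `M.start`, within the exterior face.
The new edge is `inr false`, pointing away from `M`, with inverse `inr true`. -/
noncomputable def spikeGraph : RotationGraph (Option M.V) (M.A ⊕ Bool) where
  org := Sum.elim (fun a => some (M.graph.org a))
    (fun i => if i then none else some (M.graph.org M.start))
  inv := Sum.map M.graph.inv not
  inv_inv := by rintro (a | i) <;> simp [M.graph.inv_inv]
  inv_ne := by rintro (a | i) <;> simp [M.graph.inv_ne]
  rot := Equiv.swap (Sum.inr false) (Sum.inl M.start) * Equiv.sumCongr M.graph.rot 1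
  sameCycle_rot := by
    set σ := Equiv.swap (Sum.inr false) (Sum.inl M.start) * Equiv.sumCongr M.graph.rot
      (1 : Equiv.Perm Bool) with hσ
    have h₀ : σ (Sum.inr false) = Sum.inl M.start := by simp [hσ]
    have h₁ : σ (Sum.inr true) = Sum.inr true := by
      simp [hσ, Equiv.swap_apply_of_ne_of_ne]
    have h₂ : ∀ x, M.graph.rot x = M.start → σ (Sum.inl x) = Sum.inr false := by
      intro x hx
      simp [hσ, hx]
    have h₃ : ∀ x, M.graph.rot x ≠ M.start → σ (Sum.inl x) = Sum.inl (M.graph.rot x) := by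
      intro x hx
      simp [hσ, Equiv.swap_apply_of_ne_of_ne, hx]
    have hs : σ.SameCycle (Sum.inr false) (Sum.inl M.start) :=
      h₀ ▸ Equiv.Perm.sameCycle_apply_right.2 (.refl _ _)
    have hl : ∀ x y, M.graph.org x = M.graph.org y → σ.SameCycle (Sum.inl x) (Sum.inl y) := by
      intro x y hxy
      refine sameCycle_map Sum.inl (fun x => ?_) ((M.graph.sameCycle_rot x y).2 hxy)
      have : σ.SameCycle (Sum.inl x) (σ (Sum.inl x)) :=
        Equiv.Perm.sameCycle_apply_right.2 (.refl _ _)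
      by_cases hx : M.graph.rot x = M.start
      · rw [hx]
        rw [h₂ x hx] at this
        exact this.trans hs
      · rwa [h₃ x hx] at this
    refine fun a b => ⟨eq_of_sameCycle _ ?_, ?_⟩
    · rintro (x | _ | _)
      · by_cases hx : M.graph.rot x = M.start
        · simp [h₂ x hx, ← hx, M.graph.org_rot]
        · simp [h₃ x hx, M.graph.org_rot]
      · simp [h₀]
      · simp [h₁]
    · rcases a with x | _ | _ <;> rcases b with y | _ | _ <;> intro h <;> simp at h
      · exact hl x y h
      · exact (hl _ _ h).trans hs.symm
      · exact hs.trans (hl _ _ h)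
      · exact .refl _ _
      · exact .refl _ _

theorem spikeGraph_next_inl_of_eq {x : M.A} (h : M.graph.next x = M.start) :
    M.spikeGraph.next (Sum.inl x) = Sum.inr false := by
  have h : M.graph.rot (M.graph.inv x) = M.start := h
  simp [RotationGraph.next, spikeGraph, h]

theorem spikeGraph_next_inl_of_ne {x : M.A} (h : M.graph.next x ≠ M.start) :
    M.spikeGraph.next (Sum.inl x) = Sum.inl (M.graph.next x) := by
  have h : M.graph.rot (M.graph.inv x) ≠ M.start := h
  simp [RotationGraph.next, spikeGraph, h, Equiv.swap_apply_of_ne_of_ne]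

theorem spikeGraph_next_true : M.spikeGraph.next (Sum.inr true) = Sum.inl M.start := by
  simp [RotationGraph.next, spikeGraph]

theorem spikeGraph_next_false : M.spikeGraph.next (Sum.inr false) = Sum.inr true := by
  simp [RotationGraph.next, spikeGraph, Equiv.swap_apply_of_ne_of_ne]

/-- The boundary path of the exterior face after a spike has been attached. -/
theorem run_spikeGraph : Run M.spikeGraph.next (Sum.inr true)
    (Sum.inr true :: (M.outer.map Sum.inl ++ [Sum.inr false])) (Sum.inr true) := by
  refine ⟨rfl, run_append.2 ⟨Sum.inr false, ?_, rfl, spikeGraph_next_false M⟩⟩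
  rw [spikeGraph_next_true]
  refine M.run_outer.map Sum.inl M.outer_ne_nil (fun x _ hx' => ?_)
    (fun x _ hx => spikeGraph_next_inl_of_eq M hx)
  refine spikeGraph_next_inl_of_ne M fun h => ?_
  have hn := M.nodup_outer
  have hr := M.run_outer
  generalize M.outer = l at *
  cases l with
  | nil => simp at hx'
  | cons y l =>
    rw [h, ← hr.1] at hx'
    exact (List.nodup_cons.1 hn).1 hx'

/-- Attaching an edge to a diagram at its base vertex. -/
noncomputable def spike {q : W} {y : List B} (hy : Γ.IsPath q y M.base) : Diagram Γ where
  V := Option M.V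
  A := M.A ⊕ Bool
  F := M.F
  graph := M.spikeGraph
  connected := by
    have hc : ∀ q, ∃ l, M.spikeGraph.IsPath (some (M.graph.org M.start)) l (some q) := by
      intro q
      obtain ⟨l, hl⟩ := M.connected.2 (M.graph.org M.start) q
      exact DartGraph.exists_isPath_map (Γ := M.graph.toDartGraph)
        (Δ := M.spikeGraph.toDartGraph) some
        (fun a => ⟨[Sum.inl a], rfl, rfl⟩) hl
    refine DartGraph.connected_of_base (some (M.graph.org M.start)) fun q => ?_
    cases q with
    | some q => exact hc q
    | none => exact ⟨[Sum.inr false], rfl, rfl⟩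
  faceOf := Sum.elim M.faceOf (fun _ => M.faceOf M.start)
  faceOf_surjective f := by
    obtain ⟨a, rfl⟩ := M.faceOf_surjective f
    exact ⟨Sum.inl a, rfl⟩
  sameCycle_next := by
    have hr := M.run_spikeGraph
    rw [← RotationGraph.coe_nextPerm] at hr
    have ho : ∀ a : M.A ⊕ Bool, Sum.elim M.faceOf (fun _ => M.faceOf M.start) a =
        M.faceOf M.start → M.spikeGraph.nextPerm.SameCycle (Sum.inr true) a := by
      rintro (x | _ | _) h
      · exact hr.sameCycle (by simpa using (M.mem_outer x).2 h)
      · exact hr.sameCycle (by simp)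
      · exact .refl _ _
    have hl : ∀ x y, M.graph.nextPerm.SameCycle x y →
        M.spikeGraph.nextPerm.SameCycle (Sum.inl x) (Sum.inl y) := by
      refine fun x y => sameCycle_map Sum.inl fun x => ?_
      by_cases hx : M.graph.next x = M.start
      · refine (ho _ ?_).symm.trans (ho _ ?_)
        · simp [← hx, M.faceOf_next]
        · simp [hx]
      · rw [RotationGraph.nextPerm_apply, ← spikeGraph_next_inl_of_ne M hx]
        exact Equiv.Perm.sameCycle_apply_right.2 (.refl _ _)
    refine fun a b => ⟨eq_of_sameCycle _ ?_, fun h => ?_⟩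
    · rintro (x | _ | _)
      · by_cases hx : M.graph.next x = M.start
        · simp [spikeGraph_next_inl_of_eq M hx, ← M.faceOf_next x, hx]
        · simp [spikeGraph_next_inl_of_ne M hx, M.faceOf_next]
      · simp [spikeGraph_next_false]
      · simp [spikeGraph_next_true]
    · by_cases hs : Sum.elim M.faceOf (fun _ => M.faceOf M.start) a = M.faceOf M.start
      · exact (ho a hs).symm.trans (ho b (h ▸ hs))
      · have hs' := h ▸ hs
        rcases a with x | i
        · rcases b with y | j
          · exact hl x y ((M.sameCycle_next x y).2 h)
          · exact absurd rfl hs'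
        · exact absurd rfl hs
  euler := by
    have := M.euler
    simp only [Fintype.card_option, Fintype.card_sum, Fintype.card_bool]
    omega
  onV := fun o => o.elim q M.onV
  label := Sum.elim M.label (fun i => if i then y else Γ.rev y)
  isPath_label := by
    rintro (x | _ | _)
    · exact M.isPath_label x
    · exact hy.rev
    · exact hy
  label_inv := by
    rintro (x | _ | _)
    · exact M.label_inv x
    · simp [spikeGraph]
    · simp [spikeGraph]
  start := Sum.inr true
  outer := Sum.inr true :: (M.outer.map Sum.inl ++ [Sum.inr false])
  run_outer := M.run_spikeGraph
  nodup_outer := by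
    simp [List.nodup_append, M.nodup_outer.map Sum.inl_injective]
  mem_outer := by
    rintro (x | _ | _) <;> simp [M.mem_outer]

theorem word_spike {q : W} {y : List B} (hy : Γ.IsPath q y M.base) :
    (M.spike hy).word = y ++ M.word ++ Γ.rev y := by
  simp [word, spike, List.flatMap_append, List.flatMap_map]

theorem base_spike {q : W} {y : List B} (hy : Γ.IsPath q y M.base) :
    (M.spike hy).base = q := by
  simp [base, spike, spikeGraph]

theorem perimeter_spike {q : W} {y : List B} (hy : Γ.IsPath q y M.base) {f : M.F}
    (hf : f ≠ M.faceOf M.start) : (M.spike hy).perimeter f = M.perimeter f := by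
  refine (Fintype.sum_sum_type _).trans ?_
  simp only [spike, Sum.elim_inl, Sum.elim_inr, hf.symm, if_false, Finset.sum_const_zero, add_zero]
  rfl

end Spike

end Diagram

/-! ### Adding a chord to a diagram -/

namespace Diagram

variable {W : Type u'} {B : Type v'} {Γ : DartGraph W B}

section Chord

variable (M : Diagram Γ) (b : M.A)

open Classical in
/-- Joining the corners before `M.start` and before `b` by an edge within the exterior face. The new
edge is `inr true`, pointing from the first corner to the second one, with inverse `inr false`. -/
noncomputable def chordGraph : RotationGraph M.V (M.A ⊕ Bool) where
  org := Sum.elim M.graph.org (fun i => if i then M.graph.org M.start else M.graph.org b)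
  inv := Sum.map M.graph.inv not
  inv_inv := by rintro (a | i) <;> simp [M.graph.inv_inv]
  inv_ne := by rintro (a | i) <;> simp [M.graph.inv_ne]
  rot := Equiv.swap (Sum.inr true) (Sum.inl M.start) *
    (Equiv.swap (Sum.inr false) (Sum.inl b) * Equiv.sumCongr M.graph.rot 1)
  sameCycle_rot := by
    set σ := Equiv.swap (Sum.inr true) (Sum.inl M.start) *
      (Equiv.swap (Sum.inr false) (Sum.inl b) * Equiv.sumCongr M.graph.rot
        (1 : Equiv.Perm Bool)) with hσ
    have step : ∀ z, σ.SameCycle z (σ z) := fun z =>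
      Equiv.Perm.sameCycle_apply_right.2 (.refl _ _)
    have h₀ : σ (Sum.inr true) = Sum.inl M.start := by
      simp [hσ, Equiv.swap_apply_of_ne_of_ne]
    have h₁ : M.start ≠ b → σ (Sum.inr false) = Sum.inl b := by
      intro h
      simp [hσ, Equiv.swap_apply_of_ne_of_ne, h.symm]
    have h₁' : M.start = b → σ (Sum.inr false) = Sum.inr true := by
      rintro rfl
      simp [hσ]
    have h₂ : ∀ x, M.graph.rot x = b → σ (Sum.inl x) = Sum.inr false := by
      intro x hx
      simp [hσ, hx, Equiv.swap_apply_of_ne_of_ne]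
    have h₂' : ∀ x, M.graph.rot x ≠ b → M.graph.rot x = M.start →
        σ (Sum.inl x) = Sum.inr true := by
      intro x hx hx'
      rw [hx'] at hx
      simp [hσ, hx', Equiv.swap_apply_of_ne_of_ne, hx]
    have h₃ : ∀ x, M.graph.rot x ≠ b → M.graph.rot x ≠ M.start →
        σ (Sum.inl x) = Sum.inl (M.graph.rot x) := by
      intro x hx hx'
      simp [hσ, Equiv.swap_apply_of_ne_of_ne, hx, hx']
    have hs : σ.SameCycle (Sum.inr true) (Sum.inl M.start) := h₀ ▸ step _
    have hb : σ.SameCycle (Sum.inr false) (Sum.inl b) := by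
      by_cases h : M.start = b
      · have := h₁' h ▸ step (Sum.inr false)
        exact this.trans (h ▸ hs)
      · exact h₁ h ▸ step _
    have hl : ∀ x y, M.graph.org x = M.graph.org y → σ.SameCycle (Sum.inl x) (Sum.inl y) := by
      intro x y hxy
      refine sameCycle_map Sum.inl (fun x => ?_) ((M.graph.sameCycle_rot x y).2 hxy)
      have := step (Sum.inl x)
      by_cases hx : M.graph.rot x = b
      · rw [hx]
        rw [h₂ x hx] at this
        exact this.trans hb
      · by_cases hx' : M.graph.rot x = M.start
        · rw [hx']
          rw [h₂' x hx hx'] at this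
          exact this.trans hs
        · rwa [h₃ x hx hx'] at this
    have hc : ∀ z : M.A ⊕ Bool, ∃ x, σ.SameCycle z (Sum.inl x) ∧
        Sum.elim M.graph.org
          (fun i => if i then M.graph.org M.start else M.graph.org b) z = M.graph.org x := by
      rintro (x | _ | _)
      · exact ⟨x, .refl _ _, rfl⟩
      · exact ⟨b, hb, rfl⟩
      · exact ⟨M.start, hs, rfl⟩
    refine fun z w => ⟨eq_of_sameCycle _ ?_, fun h => ?_⟩
    · rintro (x | _ | _)
      · by_cases hx : M.graph.rot x = b
        · simp [h₂ x hx, ← hx, M.graph.org_rot]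
        · by_cases hx' : M.graph.rot x = M.start
          · simp [h₂' x hx hx', ← hx', M.graph.org_rot]
          · simp [h₃ x hx hx', M.graph.org_rot]
      · by_cases h : M.start = b
        · simp [h₁' h, h]
        · simp [h₁ h]
      · simp [h₀]
    · obtain ⟨x, hx, hx'⟩ := hc z
      obtain ⟨y, hy, hy'⟩ := hc w
      exact hx.trans ((hl x y (hx'.symm.trans (h.trans hy'))).trans hy.symm)

theorem chordGraph_next_of_eq {x : M.A} (h : M.graph.next x = b) :
    (M.chordGraph b).next (Sum.inl x) = Sum.inr false := by
  have h : M.graph.rot (M.graph.inv x) = b := h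
  simp [RotationGraph.next, chordGraph, h, Equiv.swap_apply_of_ne_of_ne]

theorem chordGraph_next_of_eq_start {x : M.A} (hb : M.start ≠ b)
    (h : M.graph.next x = M.start) :
    (M.chordGraph b).next (Sum.inl x) = Sum.inr true := by
  have h : M.graph.rot (M.graph.inv x) = M.start := h
  simp [RotationGraph.next, chordGraph, h, Equiv.swap_apply_of_ne_of_ne, hb]

theorem chordGraph_next_of_ne {x : M.A} (hb : M.graph.next x ≠ b)
    (hs : M.graph.next x ≠ M.start) :
    (M.chordGraph b).next (Sum.inl x) = Sum.inl (M.graph.next x) := by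
  have hb : M.graph.rot (M.graph.inv x) ≠ b := hb
  have hs : M.graph.rot (M.graph.inv x) ≠ M.start := hs
  simp [RotationGraph.next, chordGraph, hb, hs, Equiv.swap_apply_of_ne_of_ne]

theorem chordGraph_next_false : (M.chordGraph b).next (Sum.inr false) = Sum.inl M.start := by
  simp [RotationGraph.next, chordGraph, Equiv.swap_apply_of_ne_of_ne]

theorem chordGraph_next_true (hb : M.start ≠ b) :
    (M.chordGraph b).next (Sum.inr true) = Sum.inl b := by
  simp [RotationGraph.next, chordGraph, Equiv.swap_apply_of_ne_of_ne, hb.symm]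

theorem chordGraph_next_true_of_eq (hb : M.start = b) :
    (M.chordGraph b).next (Sum.inr true) = Sum.inr true := by
  subst hb
  simp [RotationGraph.next, chordGraph]

variable {M b} {l l' : List M.A} (h : M.outer = l ++ l') (hne : l ≠ [])
  (hl : Run M.graph.next M.start l b) (hl' : Run M.graph.next b l' M.start)

include h hne hl hl'

/-- The corners joined by a chord occur in the two parts of the exterior boundary only where they
have to. They coincide if the second part is empty; then the chord is a loop. -/
theorem not_mem_of_chord : M.start ∉ l.tail ∧ b ∉ l.tail ∧ M.start ∉ l' ∧ b ∉ l'.tail ∧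
    (M.start = b ↔ l' = []) := by
  have hn := M.nodup_outer
  rw [h] at hn
  have hs : M.start ∈ l := hl.start_mem hne
  obtain ⟨hn₁, hn₂, hd⟩ := List.nodup_append.1 hn
  have hsl : M.start ∉ l.tail := by
    cases l with
    | nil => simp
    | cons x l => rw [← hl.1]; exact (List.nodup_cons.1 hn₁).1
  have hsl' : M.start ∉ l' := fun h' => hd _ hs _ h' rfl
  cases l' with
  | nil =>
    have hb : b = M.start := hl'
    subst hb
    simp [hsl]
  | cons y l' =>
    have hy : y = b := hl'.1
    subst hy
    have h₁ : y ∉ l' := (List.nodup_cons.1 hn₂).1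
    have h₂ : y ∉ l := fun h' => hd _ h' _ (by simp) rfl
    refine ⟨hsl, fun h' => h₂ (List.mem_of_mem_tail h'), hsl', h₁, ?_⟩
    simp only [reduceCtorEq, iff_false]
    rintro rfl
    exact h₂ hs

/-- The boundary path of the face cut off by a chord. -/
theorem run_chordGraph_inner : Run (M.chordGraph b).next (Sum.inr false)
    (Sum.inr false :: l.map Sum.inl) (Sum.inr false) := by
  obtain ⟨h₁, h₂, -⟩ := not_mem_of_chord h hne hl hl'
  refine ⟨rfl, ?_⟩
  rw [chordGraph_next_false]
  refine hl.map Sum.inl hne (fun x _ hx => chordGraph_next_of_ne M b ?_ ?_)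
    (fun x _ hx => chordGraph_next_of_eq M b hx)
  · rintro h'
    exact h₂ (h' ▸ hx)
  · rintro h'
    exact h₁ (h' ▸ hx)

/-- The boundary path of the exterior face after a chord has been added. -/
theorem run_chordGraph_outer : Run (M.chordGraph b).next (Sum.inr true)
    (Sum.inr true :: l'.map Sum.inl) (Sum.inr true) := by
  obtain ⟨-, -, h₁, h₂, h₃⟩ := not_mem_of_chord h hne hl hl'
  refine ⟨rfl, ?_⟩
  by_cases hb : l' = []
  · rw [chordGraph_next_true_of_eq M b (h₃.2 hb), hb]
    rfl
  · have hb' : M.start ≠ b := fun h' => hb (h₃.1 h')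
    rw [chordGraph_next_true M b hb']
    refine hl'.map Sum.inl hb (fun x _ hx => chordGraph_next_of_ne M b ?_ ?_)
      (fun x _ hx => chordGraph_next_of_eq_start M b hb' hx)
    · rintro h'
      exact h₂ (h' ▸ hx)
    · rintro h'
      exact h₁ (h' ▸ List.mem_of_mem_tail hx)

open Classical in
/-- Joining two vertices on the exterior boundary of a diagram by an edge labelled `y`: the part `l`
of the exterior boundary, followed by the inverse of the new edge, bounds a new interior face, and
the new edge takes the place of `l` in the exterior boundary. The new face is `none`. -/
noncomputable def chord {y : List B}
    (hy : Γ.IsPath M.base y (M.onV (M.graph.org b))) : Diagram Γ where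
  V := M.V
  A := M.A ⊕ Bool
  F := Option M.F
  graph := M.chordGraph b
  connected := by
    refine ⟨M.connected.1, fun p q => ?_⟩
    obtain ⟨l, hl⟩ := M.connected.2 p q
    exact DartGraph.exists_isPath_map (Γ := M.graph.toDartGraph)
      (Δ := (M.chordGraph b).toDartGraph) id (fun a => ⟨[Sum.inl a], rfl, rfl⟩) hl
  faceOf := Sum.elim (fun x => if x ∈ l then none else some (M.faceOf x))
    (fun i => if i then some (M.faceOf M.start) else none)
  faceOf_surjective := by
    rintro (_ | f)
    · exact ⟨Sum.inr false, rfl⟩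
    · by_cases hf : f = M.faceOf M.start
      · exact ⟨Sum.inr true, by simp [hf]⟩
      · obtain ⟨x, rfl⟩ := M.faceOf_surjective f
        refine ⟨Sum.inl x, ?_⟩
        have : x ∉ l := fun hx => hf ((M.mem_outer x).1 (by simp [h, hx]))
        simp [this]
  sameCycle_next := by
    have hr := run_chordGraph_inner h hne hl hl'
    have hr' := run_chordGraph_outer h hne hl hl'
    rw [← RotationGraph.coe_nextPerm] at hr hr'
    have hmem : ∀ x, M.faceOf x = M.faceOf M.start ↔ x ∈ l ∨ x ∈ l' := by
      intro x
      rw [← M.mem_outer, h, List.mem_append]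
    have hb : b ∉ l ∨ M.start = b := by
      by_cases hl₀ : l' = []
      · exact Or.inr ((not_mem_of_chord h hne hl hl').2.2.2.2.2 hl₀)
      · left
        intro hb
        have hn := M.nodup_outer
        rw [h, List.nodup_append] at hn
        exact hn.2.2 _ hb _ (hl'.start_mem hl₀) rfl
    have hbo : M.faceOf b = M.faceOf M.start := by
      obtain ⟨x, hx, rfl⟩ := hl.exists_last hne
      rw [M.faceOf_next, ← M.mem_outer, h]
      simp [hx]
    set fc : M.A ⊕ Bool → Option M.F :=
      Sum.elim (fun x => if x ∈ l then none else some (M.faceOf x))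
        (fun i => if i then some (M.faceOf M.start) else none) with hfc
    -- The faces `none` and `some (M.faceOf M.start)` are single orbits because of the two runs; the
    -- orbits of the other faces are unchanged.
    have hin : ∀ z, fc z = none → (M.chordGraph b).nextPerm.SameCycle (Sum.inr false) z := by
      rintro (x | _ | _) hz
      · refine hr.sameCycle ?_
        by_cases hx : x ∈ l
        · simp [hx]
        · simp [hfc, hx] at hz
      · exact .refl _ _
      · simp [hfc] at hz
    have hout : ∀ z, fc z = some (M.faceOf M.start) →
        (M.chordGraph b).nextPerm.SameCycle (Sum.inr true) z := by
      rintro (x | _ | _) hz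
      · refine hr'.sameCycle ?_
        by_cases hx : x ∈ l
        · simp [hfc, hx] at hz
        · simp only [hfc, Sum.elim_inl, hx, if_false, Option.some.injEq, hmem, false_or] at hz
          simp [hz]
      · simp [hfc] at hz
      · exact .refl _ _
    have hint : ∀ x y, M.graph.nextPerm.SameCycle x y → M.faceOf x ≠ M.faceOf M.start →
        (M.chordGraph b).nextPerm.SameCycle (Sum.inl x) (Sum.inl y) := by
      intro x y hxy
      refine (rel_of_sameCycle (r := fun x y => M.faceOf x = M.faceOf y ∧
        (M.faceOf x ≠ M.faceOf M.start →
          (M.chordGraph b).nextPerm.SameCycle (Sum.inl x) (Sum.inl y)))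
        ⟨fun _ => ⟨rfl, fun _ => .refl _ _⟩, fun h => ⟨h.1.symm, fun h' => (h.2 (h.1 ▸ h')).symm⟩,
          fun h h' => ⟨h.1.trans h'.1, fun hx => (h.2 hx).trans (h'.2 (h.1 ▸ hx))⟩⟩ ?_ hxy).2
      refine fun x => ⟨(M.faceOf_next x).symm, fun hx => ?_⟩
      have h₁ : M.graph.next x ≠ b := by
        intro h'
        rw [← M.faceOf_next, h'] at hx
        exact hx hbo
      have h₂ : M.graph.next x ≠ M.start := by
        intro h'
        rw [← M.faceOf_next, h'] at hx
        exact hx rfl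
      rw [RotationGraph.nextPerm_apply, ← chordGraph_next_of_ne M b h₁ h₂]
      exact Equiv.Perm.sameCycle_apply_right.2 (.refl _ _)
    refine fun z w => ⟨eq_of_sameCycle _ ?_, fun hzw => ?_⟩
    · rintro (x | _ | _)
      · rw [RotationGraph.nextPerm_apply]
        by_cases hx : M.graph.next x = b
        · obtain ⟨x', hx', h'⟩ := hl.exists_last hne
          have : x' = x := M.graph.next_injective (h'.trans hx.symm)
          subst this
          simp [hfc, chordGraph_next_of_eq M b hx, hx']
        · by_cases hx' : M.graph.next x = M.start
          · have hxl : x ∉ l := by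
              intro hxl
              rcases hl.apply_mem hxl with h' | h'
              · rw [hx'] at h'
                exact (not_mem_of_chord h hne hl hl').1 h'
              · exact hx h'
            have hsb : M.start ≠ b := fun h' => hx (hx'.trans h')
            simp [hfc, chordGraph_next_of_eq_start M b hsb hx', hxl, ← M.faceOf_next x, hx']
          · have : x ∈ l ↔ M.graph.next x ∈ l := by
              constructor
              · intro hxl
                rcases hl.apply_mem hxl with h' | h'
                · exact List.mem_of_mem_tail h'
                · exact absurd h' hx
              · intro hxl
                rcases hl.exists_pred hxl with h' | ⟨x', hx', h'⟩
                · exact absurd h' hx'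
                · rwa [← M.graph.next_injective h']
            simp [hfc, chordGraph_next_of_ne M b hx hx', this, M.faceOf_next]
      · simp [hfc, chordGraph_next_false, hl.start_mem hne]
      · rw [RotationGraph.nextPerm_apply]
        by_cases hsb : M.start = b
        · rw [chordGraph_next_true_of_eq M b hsb]
        · simp [hfc, chordGraph_next_true M b hsb, hb.resolve_right hsb, hbo]
    · by_cases hz : fc z = none
      · exact (hin z hz).symm.trans (hin w (hzw ▸ hz))
      by_cases hz' : fc z = some (M.faceOf M.start)
      · exact (hout z hz').symm.trans (hout w (hzw ▸ hz'))
      rcases z with x | _ | _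
      · rcases w with y | _ | _
        · have hx : x ∉ l := fun hx => hz (by simp [hfc, hx])
          have hy : y ∉ l := fun hy => hz (hzw.trans (by simp [hfc, hy]))
          have hxy : M.faceOf x = M.faceOf y := by simpa [hfc, hx, hy] using hzw
          refine hint x y ((M.sameCycle_next x y).2 hxy) fun h' => hz' ?_
          simp [hfc, hx, h']
        · exact absurd hzw hz
        · exact absurd hzw hz'
      · exact absurd rfl hz
      · exact absurd rfl hz'
  euler := by
    have := M.euler
    simp only [Fintype.card_option, Fintype.card_sum, Fintype.card_bool]
    omega
  onV := M.onV
  label := Sum.elim M.label (fun i => if i then y else Γ.rev y)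
  isPath_label := by
    rintro (x | _ | _)
    · exact M.isPath_label x
    · exact hy.rev
    · exact hy
  label_inv := by
    rintro (x | _ | _)
    · exact M.label_inv x
    · simp [chordGraph]
    · simp [chordGraph]
  start := Sum.inr true
  outer := Sum.inr true :: l'.map Sum.inl
  run_outer := run_chordGraph_outer h hne hl hl'
  nodup_outer := by
    have := M.nodup_outer
    rw [h, List.nodup_append] at this
    simp [this.2.1.map Sum.inl_injective]
  mem_outer := by
    have hn := M.nodup_outer
    rw [h, List.nodup_append] at hn
    rintro (x | _ | _)
    · by_cases hx : x ∈ l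
      · have : x ∉ l' := fun h' => hn.2.2 _ hx _ h' rfl
        simp [hx, this]
      · simp [hx, ← M.mem_outer, h]
    · simp
    · simp

variable {y : List B} (hy : Γ.IsPath M.base y (M.onV (M.graph.org b)))

theorem word_chord : (chord h hne hl hl' hy).word = y ++ l'.flatMap M.label := by
  simp [word, chord, List.flatMap_map]

theorem base_chord : (chord h hne hl hl' hy).base = M.base := by
  simp [base, chord, chordGraph]

theorem perimeter_chord_none :
    (chord h hne hl hl' hy).perimeter none = (l.flatMap M.label).length + y.length := by
  classical
  have hn := M.nodup_outer
  rw [h, List.nodup_append] at hn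
  refine (Fintype.sum_sum_type _).trans ?_
  rw [List.length_flatMap, ← List.sum_toFinset _ hn.1, ← Finset.sum_ite_mem_eq l.toFinset]
  simp [chord]

theorem perimeter_chord_some {f : M.F} (hf : f ≠ M.faceOf M.start) :
    (chord h hne hl hl' hy).perimeter (some f) = M.perimeter f := by
  classical
  refine (Fintype.sum_sum_type _).trans ?_
  have hx : ∀ x : M.A, (if x ∈ l then none else some (M.faceOf x)) = some f ↔
      M.faceOf x = f := by
    intro x
    by_cases hx : x ∈ l
    · have : M.faceOf x = M.faceOf M.start := by
        rw [← M.mem_outer, h]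
        simp [hx]
      simp [hx, this, hf.symm]
    · simp [hx]
  simp only [chord, Sum.elim_inl, Sum.elim_inr, hx, Fintype.univ_bool]
  simp only [↓reduceIte, reduceCtorEq, Option.some.injEq, hf.symm, Finset.sum_insert,
    Finset.mem_singleton, Finset.sum_singleton, Bool.false_eq_true, add_zero, not_false_eq_true]
  rfl

end Chord

end Diagram

/-! ### Subdividing the edges of a diagram -/

namespace Diagram

variable {W : Type u'} {B : Type v'} {Γ : DartGraph W B}

section Subdivide

variable (M : Diagram Γ) (a : M.A)

open Classical in
/-- Subdividing an edge. The first and the second half of the oriented edge `a` are `inl a` and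
`inr true`, those of its inverse `a'` are `inl a'` and `inr false`. -/
noncomputable def subdivideGraph : RotationGraph (Option M.V) (M.A ⊕ Bool) where
  org := Sum.elim (fun x => some (M.graph.org x)) (fun _ => none)
  inv := Sum.elim
    (fun x => if x = a then Sum.inr false else if x = M.graph.inv a then Sum.inr true
      else Sum.inl (M.graph.inv x))
    (fun i => if i then Sum.inl (M.graph.inv a) else Sum.inl a)
  inv_inv := by
    rintro (x | _ | _)
    · by_cases h : x = a
      · simp [h]
      · by_cases h' : x = M.graph.inv a
        · simp [h', M.graph.inv_ne]
        · have h₁ : M.graph.inv x ≠ a := fun h₁ => h' (by rw [← h₁, M.graph.inv_inv])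
          have h₂ : M.graph.inv x ≠ M.graph.inv a := fun h₂ => h (M.graph.inv_injective h₂)
          simp [h, h', h₁, h₂, M.graph.inv_inv]
    · simp
    · simp [M.graph.inv_ne]
  inv_ne := by
    rintro (x | _ | _)
    · by_cases h : x = a
      · simp [h]
      · by_cases h' : x = M.graph.inv a
        · simp [h', M.graph.inv_ne]
        · simp [h, h', M.graph.inv_ne]
    · simp
    · simp
  rot := Equiv.sumCongr M.graph.rot (Equiv.swap true false)
  sameCycle_rot := by
    set σ := Equiv.sumCongr M.graph.rot (Equiv.swap true false) with hσ
    have step : ∀ z, Equiv.Perm.SameCycle σ z (σ z) := fun z =>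
      Equiv.Perm.sameCycle_apply_right.2 (.refl _ _)
    have ht : Equiv.Perm.SameCycle σ (Sum.inr true) (Sum.inr false) := step _
    refine fun z w => ⟨eq_of_sameCycle _ ?_, ?_⟩
    · rintro (x | _)
      · simp [hσ, M.graph.org_rot]
      · simp [hσ]
    · rcases z with x | _ | _ <;> rcases w with y | _ | _ <;> intro h <;> simp at h
      · exact sameCycle_map Sum.inl (fun x => step (Sum.inl x)) ((M.graph.sameCycle_rot x y).2 h)
      · exact .refl _ _
      · exact ht.symm
      · exact ht
      · exact .refl _ _

theorem subdivideGraph_next_self : (M.subdivideGraph a).next (Sum.inl a) = Sum.inr true := by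
  simp [RotationGraph.next, subdivideGraph]

theorem subdivideGraph_next_inv :
    (M.subdivideGraph a).next (Sum.inl (M.graph.inv a)) = Sum.inr false := by
  simp [RotationGraph.next, subdivideGraph, M.graph.inv_ne]

theorem subdivideGraph_next_of_ne {x : M.A} (h : x ≠ a) (h' : x ≠ M.graph.inv a) :
    (M.subdivideGraph a).next (Sum.inl x) = Sum.inl (M.graph.next x) := by
  simp [RotationGraph.next, subdivideGraph, h, h']

theorem subdivideGraph_next_true :
    (M.subdivideGraph a).next (Sum.inr true) = Sum.inl (M.graph.next a) := by
  simp [RotationGraph.next, subdivideGraph]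

theorem subdivideGraph_next_false :
    (M.subdivideGraph a).next (Sum.inr false) = Sum.inl (M.graph.next (M.graph.inv a)) := by
  simp [RotationGraph.next, subdivideGraph, M.graph.inv_inv]

theorem subdivideGraph_term_self : (M.subdivideGraph a).term (Sum.inl a) = none := by
  simp [DartGraph.term, subdivideGraph]

theorem subdivideGraph_term_inv :
    (M.subdivideGraph a).term (Sum.inl (M.graph.inv a)) = none := by
  simp [DartGraph.term, subdivideGraph, M.graph.inv_ne]

theorem subdivideGraph_term_of_ne {x : M.A} (h : x ≠ a) (h' : x ≠ M.graph.inv a) :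
    (M.subdivideGraph a).term (Sum.inl x) = some (M.graph.term x) := by
  simp [DartGraph.term, subdivideGraph, h, h']

theorem subdivideGraph_term_true :
    (M.subdivideGraph a).term (Sum.inr true) = some (M.graph.term a) := rfl

theorem subdivideGraph_term_false :
    (M.subdivideGraph a).term (Sum.inr false) = some (M.graph.org a) := rfl

open Classical in
/-- The oriented edge `x` as a path of oriented edges after the subdivision. -/
noncomputable def subdivision (x : M.A) : List (M.A ⊕ Bool) :=
  if x = a then [Sum.inl a, Sum.inr true]
  else if x = M.graph.inv a then [Sum.inl x, Sum.inr false] else [Sum.inl x]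

theorem run_subdivision (x : M.A) : Run (M.subdivideGraph a).next (Sum.inl x)
    (M.subdivision a x) (Sum.inl (M.graph.next x)) := by
  by_cases h : x = a
  · subst h
    simp [subdivision, Run, subdivideGraph_next_self, subdivideGraph_next_true]
  · by_cases h' : x = M.graph.inv a
    · subst h'
      simp [subdivision, Run, M.graph.inv_ne, subdivideGraph_next_inv, subdivideGraph_next_false]
    · simp [subdivision, Run, h, h', subdivideGraph_next_of_ne]

theorem mem_subdivision (x : M.A) (z : M.A ⊕ Bool) : z ∈ M.subdivision a x ↔
    Sum.elim id (fun i => if i then a else M.graph.inv a) z = x := by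
  by_cases h : x = a
  · subst h
    rcases z with y | _ | _ <;> simp [subdivision, M.graph.inv_ne, eq_comm]
  · by_cases h' : x = M.graph.inv a
    · subst h'
      rcases z with y | _ | _ <;> simp [subdivision, M.graph.inv_ne, (M.graph.inv_ne _).symm]
    · rcases z with y | _ | _ <;> simp [subdivision, h, h', eq_comm, Ne.symm h]

variable {M a} {l l' : List B} (h : M.label a = l ++ l')

open Classical in
/-- The labels after an edge labelled `l ++ l'` has been subdivided. -/
noncomputable def subdivideLabel (M : Diagram Γ) (a : M.A) (l l' : List B) (z : M.A ⊕ Bool) :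
    List B :=
  z.elim (fun x => if x = a then l else if x = M.graph.inv a then Γ.rev l' else M.label x)
    (fun i => if i then l' else Γ.rev l)

include h

theorem flatMap_subdivision (x : M.A) :
    (M.subdivision a x).flatMap (M.subdivideLabel a l l') = M.label x := by
  by_cases h₁ : x = a
  · subst h₁
    simp [subdivision, subdivideLabel, h]
  · by_cases h₂ : x = M.graph.inv a
    · subst h₂
      simp [subdivision, subdivideLabel, M.graph.inv_ne, M.label_inv, h]
    · simp [subdivision, subdivideLabel, h₁, h₂]

/-- Subdividing an edge labelled `l ++ l'` into one labelled `l` and one labelled `l'`. -/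
noncomputable def subdivide : Diagram Γ where
  V := Option M.V
  A := M.A ⊕ Bool
  F := M.F
  graph := M.subdivideGraph a
  connected := by
    have hc : ∀ q, ∃ l, (M.subdivideGraph a).IsPath (some (M.graph.org a)) l (some q) := by
      intro q
      obtain ⟨l, hl⟩ := M.connected.2 (M.graph.org a) q
      refine DartGraph.exists_isPath_map (Γ := M.graph.toDartGraph)
        (Δ := (M.subdivideGraph a).toDartGraph) some (fun x => ?_) hl
      by_cases h₁ : x = a
      · subst h₁
        exact ⟨[Sum.inl x, Sum.inr true], rfl, (M.subdivideGraph_term_self x).symm, rfl⟩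
      · by_cases h₂ : x = M.graph.inv a
        · subst h₂
          refine ⟨[Sum.inl (M.graph.inv a), Sum.inr false], rfl,
            (M.subdivideGraph_term_inv a).symm, ?_⟩
          rw [DartGraph.term_inv]
          rfl
        · exact ⟨[Sum.inl x], rfl, M.subdivideGraph_term_of_ne a h₁ h₂⟩
    refine DartGraph.connected_of_base (some (M.graph.org a)) fun q => ?_
    cases q with
    | some q => exact hc q
    | none => exact ⟨[Sum.inl a], rfl, M.subdivideGraph_term_self a⟩
  faceOf := fun z => M.faceOf (Sum.elim id (fun i => if i then a else M.graph.inv a) z)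
  faceOf_surjective f := by
    obtain ⟨x, rfl⟩ := M.faceOf_surjective f
    exact ⟨Sum.inl x, rfl⟩
  sameCycle_next := by
    have hr : ∀ z, (M.subdivideGraph a).nextPerm.SameCycle
        (Sum.inl (Sum.elim id (fun i => if i then a else M.graph.inv a) z)) z := by
      intro z
      have := M.run_subdivision a (Sum.elim id (fun i => if i then a else M.graph.inv a) z)
      rw [← RotationGraph.coe_nextPerm] at this
      exact this.sameCycle ((M.mem_subdivision a _ _).2 rfl)
    have hs : ∀ x, (M.subdivideGraph a).nextPerm.SameCycle
        (Sum.inl x) (Sum.inl (M.graph.next x)) := by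
      intro x
      by_cases h₁ : x = a
      · subst h₁
        rw [← M.subdivideGraph_next_true, ← RotationGraph.nextPerm_apply,
          Equiv.Perm.sameCycle_apply_right]
        exact hr (Sum.inr true)
      · by_cases h₂ : x = M.graph.inv a
        · subst h₂
          rw [← M.subdivideGraph_next_false, ← RotationGraph.nextPerm_apply,
            Equiv.Perm.sameCycle_apply_right]
          exact hr (Sum.inr false)
        · rw [← M.subdivideGraph_next_of_ne a h₁ h₂, ← RotationGraph.nextPerm_apply,
            Equiv.Perm.sameCycle_apply_right]
    refine fun z w => ⟨eq_of_sameCycle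
      (fun z => M.faceOf (Sum.elim id (fun i : Bool => if i then a else M.graph.inv a) z)) ?_,
      fun hzw => ?_⟩
    · rintro (x | _ | _)
      · by_cases h₁ : x = a
        · subst h₁
          simp [M.subdivideGraph_next_self]
        · by_cases h₂ : x = M.graph.inv a
          · subst h₂
            simp [M.subdivideGraph_next_inv]
          · simp [M.subdivideGraph_next_of_ne a h₁ h₂, M.faceOf_next]
      · simp [M.subdivideGraph_next_false, M.faceOf_next]
      · simp [M.subdivideGraph_next_true, M.faceOf_next]
    · exact (hr z).symm.trans ((sameCycle_map Sum.inl hs ((M.sameCycle_next _ _).2 hzw)).trans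
        (hr w))
  euler := by
    have := M.euler
    simp only [Fintype.card_option, Fintype.card_sum, Fintype.card_bool]
    omega
  onV := fun o => o.elim
    (Classical.choose (DartGraph.isPath_append.1 (h ▸ M.isPath_label a))) M.onV
  label := M.subdivideLabel a l l'
  isPath_label := by
    obtain ⟨h₁, h₂⟩ :=
      Classical.choose_spec (DartGraph.isPath_append.1 (h ▸ M.isPath_label a))
    rintro (x | _ | _)
    · by_cases hx : x = a
      · subst hx
        rw [subdivideGraph_term_self]
        simpa [subdivideLabel, subdivideGraph] using h₁
      · by_cases hx' : x = M.graph.inv a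
        · subst hx'
          rw [subdivideGraph_term_inv]
          have h₃ : Γ.IsPath (M.onV (M.graph.org (M.graph.inv a))) (Γ.rev l') _ := h₂.rev
          simpa [subdivideLabel, subdivideGraph, M.graph.inv_ne] using h₃
        · rw [M.subdivideGraph_term_of_ne a hx hx']
          simpa [subdivideLabel, subdivideGraph, hx, hx'] using M.isPath_label x
    · rw [subdivideGraph_term_false]
      simpa [subdivideLabel, subdivideGraph] using h₁.rev
    · rw [subdivideGraph_term_true]
      simpa [subdivideLabel, subdivideGraph] using h₂
  label_inv := by
    rintro (x | _ | _)
    · by_cases hx : x = a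
      · subst hx
        simp [subdivideLabel, subdivideGraph]
      · by_cases hx' : x = M.graph.inv a
        · subst hx'
          simp [subdivideLabel, subdivideGraph, M.graph.inv_ne]
        · have h₁ : M.graph.inv x ≠ a := fun h₁ => hx' (by rw [← h₁, M.graph.inv_inv])
          have h₂ : M.graph.inv x ≠ M.graph.inv a := fun h₂ => hx (M.graph.inv_injective h₂)
          simp [subdivideLabel, subdivideGraph, hx, hx', h₁, h₂, M.label_inv]
    · simp [subdivideLabel, subdivideGraph]
    · simp [subdivideLabel, subdivideGraph, M.graph.inv_ne]
  start := Sum.inl M.start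
  outer := M.outer.flatMap (M.subdivision a)
  run_outer := M.run_outer.flatMap Sum.inl _ (M.run_subdivision a)
  nodup_outer := by
    refine List.nodup_flatMap.2 ⟨fun x _ => ?_, M.nodup_outer.imp fun hxy => ?_⟩
    · unfold subdivision
      split_ifs <;> simp
    · intro z hz hz'
      rw [mem_subdivision] at hz hz'
      exact hxy (hz.symm.trans hz')
  mem_outer z := by
    simp [mem_subdivision, ← M.mem_outer]

theorem word_subdivide : (subdivide h).word = M.word := by
  simp only [word, subdivide, List.flatMap_assoc, flatMap_subdivision h]

open Classical in
theorem length_subdivideLabel (x : M.A) : (M.label x).length =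
    (M.subdivideLabel a l l' (Sum.inl x)).length + ((if x = a then l'.length else 0) +
      (if x = M.graph.inv a then l.length else 0)) := by
  by_cases h₁ : x = a
  · subst h₁
    simp [subdivideLabel, h, (M.graph.inv_ne _).symm]
  · by_cases h₂ : x = M.graph.inv a
    · subst h₂
      simp [subdivideLabel, h, M.graph.inv_ne, M.label_inv, add_comm]
    · simp [subdivideLabel, h₁, h₂]

theorem perimeter_subdivide (f : M.F) : (subdivide h).perimeter f = M.perimeter f := by
  classical
  refine (Fintype.sum_sum_type _).trans ?_
  have hx : ∀ x, (if M.faceOf x = f then (M.label x).length else 0) =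
      (if M.faceOf x = f then (M.subdivideLabel a l l' (Sum.inl x)).length else 0) +
      ((if x = a then if M.faceOf x = f then l'.length else 0 else 0) +
      (if x = M.graph.inv a then if M.faceOf x = f then l.length else 0 else 0)) := by
    intro x
    by_cases hf : M.faceOf x = f
    · simp [hf, length_subdivideLabel h x]
    · simp [hf]
  simp only [perimeter]
  simp only [hx, Finset.sum_add_distrib, Finset.sum_ite_eq', Finset.mem_univ, if_true]
  simp [subdivide, subdivideLabel]
  rfl

end Subdivide

/-- Every diagram can be subdivided so that all labels have length at most one. -/
theorem exists_refined (M : Diagram Γ) : ∃ M' : Diagram Γ, M'.base = M.base ∧ M'.word = M.word ∧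
    Fintype.card M'.F = Fintype.card M.F ∧
    (∀ k, (∀ f, f ≠ M.faceOf M.start → M.perimeter f ≤ k) →
      ∀ f, f ≠ M'.faceOf M'.start → M'.perimeter f ≤ k) ∧
    ∀ a, (M'.label a).length ≤ 1 := by
  classical
  induction hn : ∑ a, ((M.label a).length - 1) using Nat.strong_induction_on generalizing M with
  | _ n ih =>
    by_cases hM : ∀ a, (M.label a).length ≤ 1
    · exact ⟨M, rfl, rfl, rfl, fun k hk => hk, hM⟩
    push Not at hM
    obtain ⟨a, ha⟩ := hM
    obtain ⟨b, l, h⟩ : ∃ b l, M.label a = [b] ++ l := by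
      cases hl : M.label a with
      | nil => simp [hl] at ha
      | cons b l => exact ⟨b, l, rfl⟩
    have hl : 1 ≤ l.length := by
      rw [h] at ha
      simpa [Nat.lt_iff_add_one_le] using ha
    -- Splitting off the first edge of a label shortens both orientations of the rest.
    have hlt : ∑ z, (((subdivide h).label z).length - 1) < n := by
      refine (Fintype.sum_sum_type _).trans_lt ?_
      have hx : ∀ x, ((M.label x).length - 1) =
          ((M.subdivideLabel a [b] l (Sum.inl x)).length - 1) +
          ((if x = a then l.length else 0) + (if x = M.graph.inv a then 1 else 0)) := by
        intro x
        have := length_subdivideLabel h x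
        by_cases h₁ : x = a
        · subst h₁
          simp [subdivideLabel, h, (M.graph.inv_ne _).symm]
        · by_cases h₂ : x = M.graph.inv a
          · subst h₂
            simp [subdivideLabel, h, M.graph.inv_ne, M.label_inv]
            omega
          · simp [subdivideLabel, h₁, h₂]
      rw [← hn]
      simp only [hx, Finset.sum_add_distrib, Finset.sum_ite_eq', Finset.mem_univ, if_true]
      simp [subdivide, subdivideLabel]
    obtain ⟨M', h₁, h₂, h₃, h₄, h₅⟩ := ih _ hlt (subdivide h) rfl
    refine ⟨M', h₁, h₂.trans (word_subdivide h), h₃, fun k hk => h₄ k fun f hf => ?_, h₅⟩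
    exact (perimeter_subdivide h f).trans_le (hk f hf)

end Diagram

/-! ### Closed paths bounding diagrams -/

section Fills

variable {V : Type u} {A : Type v} {W : Type u'} {B : Type v'}

/-- `Fills Γ k n p c`: the closed path `c` at `p` is the boundary word of a disc diagram over `Γ`
with at most `n` interior faces, all of perimeter at most `k`. -/
def Fills (Γ : DartGraph W B) (k n : ℕ) (p : W) (c : List B) : Prop :=
  ∃ M : Diagram Γ, M.base = p ∧ M.word = c ∧ Fintype.card M.F ≤ n + 1 ∧
    ∀ f, f ≠ M.faceOf M.start → M.perimeter f ≤ k

variable {Γ : DartGraph W B} {k n : ℕ} {p q r : W} {c x y z w : List B}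

theorem Fills.isPath (h : Fills Γ k n p c) : Γ.IsPath p c p := by
  obtain ⟨M, rfl, rfl, -⟩ := h
  exact M.isPath_flatMap_label M.run_outer

theorem Fills.nil (Γ : DartGraph W B) (k n : ℕ) (p : W) : Fills Γ k n p [] :=
  ⟨Diagram.trivial Γ p, rfl, rfl, Nat.succ_le_succ n.zero_le, fun _ h => absurd rfl h⟩

/-- If all labels have length at most one, decompositions of the label of a path come from
decompositions of the path. -/
theorem exists_eq_append_of_flatMap {A : Type*} {P : A → List B} (hP : ∀ a, (P a).length ≤ 1)
    {l : List A} {x y : List B} (h : l.flatMap P = x ++ y) :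
    ∃ l₁ l₂, l = l₁ ++ l₂ ∧ l₁.flatMap P = x ∧ l₂.flatMap P = y := by
  induction l generalizing x with
  | nil =>
    obtain ⟨rfl, rfl⟩ := List.append_eq_nil_iff.1 h.symm
    exact ⟨[], [], rfl, rfl, rfl⟩
  | cons a l ih =>
    cases x with
    | nil => exact ⟨[], a :: l, rfl, rfl, h⟩
    | cons b x =>
      rw [List.flatMap_cons] at h
      have ha := hP a
      rcases hPa : P a with _ | ⟨b', _ | ⟨b'', t⟩⟩
      · rw [hPa] at h
        obtain ⟨l₁, l₂, rfl, h₁, h₂⟩ := ih (x := b :: x) h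
        exact ⟨a :: l₁, l₂, rfl, by simp [hPa, h₁], h₂⟩
      · rw [hPa] at h
        simp only [List.cons_append, List.nil_append, List.cons.injEq] at h
        obtain ⟨l₁, l₂, rfl, h₁, h₂⟩ := ih h.2
        exact ⟨a :: l₁, l₂, rfl, by simp [hPa, h₁, h.1], h₂⟩
      · simp [hPa] at ha

/-- A filling of `x ++ y`, by a diagram in which the boundary is accordingly split. -/
theorem Fills.exists_split (h : Fills Γ k n p (x ++ y)) (hx : Γ.IsPath p x q) :
    ∃ (M : Diagram Γ) (l l' : List M.A) (b : M.A), M.base = p ∧ Fintype.card M.F ≤ n + 1 ∧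
      (∀ f, f ≠ M.faceOf M.start → M.perimeter f ≤ k) ∧ M.outer = l ++ l' ∧
      Run M.graph.next M.start l b ∧ Run M.graph.next b l' M.start ∧
      l.flatMap M.label = x ∧ l'.flatMap M.label = y ∧ M.onV (M.graph.org b) = q := by
  obtain ⟨M₀, rfl, hw, hc, hk⟩ := h
  obtain ⟨M, h₁, h₂, h₃, h₄, h₅⟩ := M₀.exists_refined
  obtain ⟨l, l', hl, rfl, rfl⟩ := exists_eq_append_of_flatMap h₅ (h₂.trans hw)
  obtain ⟨b, hb, hb'⟩ := run_append.1 (hl ▸ M.run_outer)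
  refine ⟨M, l, l', b, h₁, h₃.trans_le hc, h₄ k hk, hl, hb, hb', rfl, rfl, ?_⟩
  rw [← h₁] at hx
  exact (M.isPath_flatMap_label hb).unique hx

/-- A filling of a closed path is a filling of its cyclic conjugates. -/
theorem Fills.rotate (h : Fills Γ k n p (x ++ y)) (hx : Γ.IsPath p x q) :
    Fills Γ k n q (y ++ x) := by
  obtain ⟨M, l, l', b, -, hc, hk, hl, hb, hb', rfl, rfl, rfl⟩ := h.exists_split hx
  have hmem : b ∈ M.outer := by
    cases l' with
    | nil =>
      rw [show b = M.start from hb']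
      exact M.start_mem
    | cons a l' =>
      rw [hl, ← hb'.1]
      simp
  refine ⟨M.rotate hl hb hb' hmem, rfl, ?_, hc, fun f hf => hk f ?_⟩
  · simp [Diagram.word, Diagram.rotate]
  · rw [← (M.mem_outer b).1 hmem]
    exact hf

theorem Fills.conj (h : Fills Γ k n p c) (hy : Γ.IsPath q y p) :
    Fills Γ k n q (y ++ c ++ Γ.rev y) := by
  obtain ⟨M, rfl, rfl, hc, hk⟩ := h
  exact ⟨M.spike hy, M.base_spike hy, M.word_spike hy, hc, fun f hf =>
    (M.perimeter_spike hy hf).trans_le (hk f hf)⟩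

theorem Diagram.fills_chord (M : Diagram Γ) (hc : Fintype.card M.F ≤ n + 1)
    (hk : ∀ f, f ≠ M.faceOf M.start → M.perimeter f ≤ k) {l l' : List M.A} {b : M.A}
    (hl : M.outer = l ++ l') (hne : l ≠ []) (hb : Run M.graph.next M.start l b)
    (hb' : Run M.graph.next b l' M.start) (hy : Γ.IsPath M.base y (M.onV (M.graph.org b)))
    (hle : (l.flatMap M.label).length + y.length ≤ k) :
    Fills Γ k (n + 1) M.base (y ++ l'.flatMap M.label) := by
  refine ⟨M.chord hl hne hb hb' hy, Diagram.base_chord hl hne hb hb' hy,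
    Diagram.word_chord hl hne hb hb' hy, ?_, ?_⟩
  · exact (Fintype.card_option (α := M.F)).trans_le (Nat.succ_le_succ hc)
  · rintro (_ | f) hf
    · exact (Diagram.perimeter_chord_none hl hne hb hb' hy).trans_le hle
    · have hf' : f ≠ M.faceOf M.start := fun h => hf (congrArg some h)
      exact (Diagram.perimeter_chord_some hl hne hb hb' hy hf').trans_le (hk f hf')

/-- One more face replaces an initial segment of the boundary word by a parallel path. -/
theorem Fills.replace_prefix (h : Fills Γ k n p (x ++ w)) (hx : Γ.IsPath p x q)
    (hy : Γ.IsPath p y q) (hle : x.length + y.length ≤ k) : Fills Γ k (n + 1) p (y ++ w) := by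
  obtain ⟨M, l, l', b, rfl, hc, hk, hl, hb, hb', rfl, rfl, rfl⟩ := h.exists_split hx
  by_cases hne : l = []
  · -- A chord cuts off a nonempty segment: first attach an edge with empty label.
    subst hne
    obtain rfl : M.start = b := hb
    have hs : Γ.IsPath M.base [] M.base := rfl
    have hr := (M.spike hs).run_outer
    refine ((congrArg₂ (Fills Γ k (n + 1)) (M.base_spike hs) ?_).mp
      ((M.spike hs).fills_chord hc (fun f hf => (M.perimeter_spike hs hf).trans_le (hk f hf))
        (l := [Sum.inr true]) (l' := M.outer.map Sum.inl ++ [Sum.inr false]) rfl (by simp)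
        ⟨rfl, rfl⟩ hr.2 (y := y) ?_ ?_))
    · simp [Diagram.spike, List.flatMap_map, hl]
    · rw [M.base_spike hs]
      simp only [M.spikeGraph_next_true, Diagram.spike]
      exact hy
    · simpa [Diagram.spike] using hle
  · exact M.fills_chord hc hk hl hne hb hb' hy hle

/-- One more face replaces a segment of the boundary word by a parallel path. -/
theorem Fills.replace (h : Fills Γ k n p (z ++ (x ++ w))) (hz : Γ.IsPath p z q)
    (hx : Γ.IsPath q x r) (hy : Γ.IsPath q y r) (hle : x.length + y.length ≤ k) :
    Fills Γ k (n + 1) p (z ++ (y ++ w)) := by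
  obtain ⟨q', hz', hxw⟩ := DartGraph.isPath_append.1 h.isPath
  obtain rfl := hz.unique hz'
  obtain ⟨r', hx', hw⟩ := DartGraph.isPath_append.1 hxw
  obtain rfl := hx.unique hx'
  have h₁ := h.rotate hz
  rw [List.append_assoc] at h₁
  have h₂ := h₁.replace_prefix hx hy hle
  rw [← List.append_assoc] at h₂
  exact h₂.rotate (DartGraph.isPath_append.2 ⟨_, hy, hw⟩)

/-- Substituting paths of length at most `N` for the edges in a filling. -/
theorem Fills.map {Δ : DartGraph V A} (h : Fills Γ k n p c) (α : W → V) {P : B → List A}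
    (hP : ∀ b, Δ.IsPath (α (Γ.org b)) (P b) (α (Γ.term b)))
    (hinv : ∀ b, P (Γ.inv b) = Δ.rev (P b)) {N : ℕ} (hN : ∀ b, (P b).length ≤ N) :
    Fills Δ (N * k) n (α p) (c.flatMap P) := by
  obtain ⟨M, rfl, rfl, hc, hk⟩ := h
  refine ⟨{ M with
      onV := fun v => α (M.onV v)
      label := fun a => (M.label a).flatMap P
      isPath_label := fun a => (M.isPath_label a).flatMap α hP
      label_inv := fun a => by rw [M.label_inv, DartGraph.flatMap_rev hinv] },
    rfl, ?_, hc, fun f hf => ?_⟩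
  · simp [Diagram.word, List.flatMap_assoc]
  · refine le_trans ?_ (Nat.mul_le_mul_left N (hk f hf))
    simp only [Diagram.perimeter, Finset.mul_sum]
    refine Finset.sum_le_sum fun a _ => ?_
    split_ifs
    · exact DartGraph.length_flatMap_le hN _
    · simp

end Fills

/-! ### Diagrams and combinatorial fillings -/

namespace RotationGraph

variable {V : Type u} {A : Type v} (D : RotationGraph V A)

theorem nodup_boundary (a : A) : (D.boundary a).Nodup := by
  refine List.Nodup.map_on (fun i hi j hj h => ?_) List.nodup_range
  exact Function.iterate_injOn_Iio_minimalPeriod (List.mem_range.1 hi) (List.mem_range.1 hj) h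

theorem run_boundary (a : A) : Run D.next a (D.boundary a) a := by
  have := run_map_range D.next a (Function.minimalPeriod D.next a)
  rwa [Function.iterate_minimalPeriod] at this

variable [Finite A]

theorem self_mem_boundary (a : A) : a ∈ D.boundary a := by
  have h : 0 < Function.minimalPeriod D.next a :=
    Function.minimalPeriod_pos_of_mem_periodicPts (D.next_injective.mem_periodicPts a)
  exact List.mem_map.2 ⟨0, List.mem_range.2 h, rfl⟩

theorem mem_boundary {a b : A} : b ∈ D.boundary a ↔ D.nextPerm.SameCycle a b := by
  constructor
  · have := D.run_boundary a
    rw [← coe_nextPerm] at this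
    exact this.sameCycle
  · rintro ⟨i, rfl⟩
    have h := D.next_injective.mem_periodicPts a
    obtain ⟨n, hn⟩ := (Equiv.Perm.SameCycle.exists_nat_pow_eq
      (⟨i, rfl⟩ : D.nextPerm.SameCycle a ((D.nextPerm ^ i) a)))
    rw [← hn, Equiv.Perm.coe_pow, coe_nextPerm, ← Function.iterate_mod_minimalPeriod_eq]
    exact List.mem_map.2 ⟨_, List.mem_range.2 (Nat.mod_lt _
      (Function.minimalPeriod_pos_of_mem_periodicPts h)), rfl⟩

theorem face_eq_iff {a b : A} : D.face a = D.face b ↔ D.nextPerm.SameCycle a b := by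
  constructor
  · intro h
    have : b ∈ D.face a := h ▸ D.self_mem_boundary b
    exact D.mem_boundary.1 this
  · intro h
    ext x
    exact D.mem_boundary.trans (Iff.trans ⟨fun h' => h.symm.trans h', fun h' => h.trans h'⟩
      D.mem_boundary.symm)

theorem eq_boundary {a : A} {l : List A} (h : Run D.next a l a) (hn : l.Nodup) (hl : l ≠ []) :
    l = D.boundary a := by
  obtain ⟨h₁, h₂⟩ := h.eq_map_range
  have hpos : 0 < l.length := List.length_pos_iff.2 hl
  have hle : Function.minimalPeriod D.next a ≤ l.length :=
    Function.IsPeriodicPt.minimalPeriod_le hpos h₂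
  have hge : l.length ≤ Function.minimalPeriod D.next a := by
    by_contra hlt
    rw [h₁] at hn
    have := List.inj_on_of_nodup_map hn
      (List.mem_range.2 hpos) (List.mem_range.2 (not_le.1 hlt))
      (Function.iterate_minimalPeriod (f := D.next) (x := a)).symm
    exact (Function.minimalPeriod_pos_of_mem_periodicPts
      (D.next_injective.mem_periodicPts a)).ne this
  rw [h₁, le_antisymm hge hle]
  rfl

end RotationGraph

section Conversion

variable {W : Type u'} {B : Type v'} {Γ : DartGraph W B} {k n : ℕ}

open Classical in
theorem length_flatMap_eq_sum {A : Type*} [Fintype A] (P : A → List B) {l : List A} (hl : l.Nodup)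
    (p : A → Prop) (hp : ∀ a, a ∈ l ↔ p a) :
    (l.flatMap P).length = ∑ a, if p a then (P a).length else 0 := by
  rw [List.length_flatMap, ← List.sum_toFinset _ hl, ← Finset.sum_ite_mem_eq l.toFinset]
  simp [hp]

/-- A filling in the sense of the definition of the spectrum, as a diagram. -/
theorem DartGraph.IsFilling.fills {c : Γ.Loop} {D : PlaneGraph}
    {φ : GenMap D.graph.toDartGraph Γ} (h : Γ.IsFilling k c D φ) :
    Fills Γ k D.area c.base c.edges := by
  have := D.finite_A
  have := D.finite_V
  obtain ⟨⟨a, ha, hb, he⟩ | ⟨-, -, he⟩, hk⟩ := h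
  swap
  · rw [he]
    exact Fills.nil _ _ _ _
  have hP : ∀ l : List D.A, φ.mapPath l = l.flatMap fun a => (φ.onA a).toList := fun l =>
    List.filterMap_eq_flatMap_toList _ l
  have hext : D.exterior = D.graph.face a := by
    obtain ⟨a', ha'⟩ := D.exterior_face ⟨a⟩
    rw [ha'] at ha ⊢
    exact D.graph.face_eq_iff.2 (D.graph.mem_boundary.1 ha)
  have hcard : D.area + 1 = Nat.card (Set.range D.graph.face) := by
    have hmem : D.exterior ∈ Set.range D.graph.face := ⟨a, hext.symm⟩
    exact (Set.ncard_sdiff_singleton_add_one hmem (Set.toFinite _)).trans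
      (Nat.card_coe_set_eq _).symm
  let _ : Fintype D.A := Fintype.ofFinite _
  let _ : Fintype D.V := Fintype.ofFinite _
  let _ : Fintype (Set.range D.graph.face) := Fintype.ofFinite _
  let M : Diagram Γ :=
    { V := D.V
      A := D.A
      F := Set.range D.graph.face
      graph := D.graph
      connected := D.connected
      faceOf := fun a => ⟨D.graph.face a, a, rfl⟩
      faceOf_surjective := by
        rintro ⟨_, a, rfl⟩
        exact ⟨a, rfl⟩
      sameCycle_next := fun a b => by
        rw [← D.graph.face_eq_iff]
        exact ⟨fun h => Subtype.ext h, fun h => congrArg Subtype.val h⟩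
      euler := by
        have h₁ := D.euler
        have h₂ : (Set.range D.graph.face \ {D.exterior}).ncard = D.area := rfl
        rw [h₂, hcard, Nat.card_eq_fintype_card, Nat.card_eq_fintype_card,
          Nat.card_eq_fintype_card] at h₁
        exact h₁
      onV := φ.onV
      label := fun a => (φ.onA a).toList
      isPath_label := fun a => by
        cases h : φ.onA a with
        | none => exact φ.map_collapsed a h
        | some b =>
          refine ⟨φ.map_org a b h, ?_⟩
          exact φ.map_org (D.graph.inv a) (Γ.inv b) (by rw [φ.map_inv, h]; rfl)
      label_inv := fun a => by
        rw [φ.map_inv]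
        cases φ.onA a <;> rfl
      start := a
      outer := D.graph.boundary a
      run_outer := D.graph.run_boundary a
      nodup_outer := D.graph.nodup_boundary a
      mem_outer := fun x => by
        rw [D.graph.mem_boundary, ← D.graph.face_eq_iff, eq_comm]
        exact ⟨fun h => Subtype.ext h, fun h => congrArg Subtype.val h⟩ }
  refine ⟨M, hb, (hP _).symm.trans he, ?_, ?_⟩
  · rw [hcard, Nat.card_eq_fintype_card]
  · rintro ⟨f, b, rfl⟩ hf
    have hb : b ∉ D.exterior := by
      intro hb
      rw [hext] at hb
      exact hf (Subtype.ext (D.graph.face_eq_iff.2 (D.graph.mem_boundary.1 hb).symm))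
    refine le_trans (le_of_eq ?_) (hk b hb)
    rw [hP, length_flatMap_eq_sum _ (D.graph.nodup_boundary b)
      (fun x => M.faceOf x = ⟨D.graph.face b, b, rfl⟩) fun x => ?_]
    · rfl
    · rw [D.graph.mem_boundary, ← D.graph.face_eq_iff, eq_comm]
      exact ⟨fun h => Subtype.ext h, fun h => congrArg Subtype.val h⟩

/-- A diagram, as a filling in the sense of the definition of the spectrum. -/
theorem Fills.exists_isFilling {c : Γ.Loop} (h : Fills Γ k n c.base c.edges) :
    ∃ (D : PlaneGraph) (φ : GenMap D.graph.toDartGraph Γ), Γ.IsFilling k c D φ ∧ D.area ≤ n := by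
  obtain ⟨M₀, hb₀, hw₀, hc₀, hk₀⟩ := h
  obtain ⟨M, hb, hw, hc, hk, hlab⟩ := M₀.exists_refined
  rw [← hc] at hc₀
  replace hk := hk k hk₀
  rw [hb₀] at hb
  rw [hw₀] at hw
  have hface : ∀ a b, M.graph.face a = M.graph.face b ↔ M.faceOf a = M.faceOf b := fun a b =>
    M.graph.face_eq_iff.trans (M.sameCycle_next a b)
  have hcard : (Set.range M.graph.face \ {M.graph.face M.start}).ncard + 1 =
      Fintype.card M.F := by
    rw [Set.ncard_sdiff_singleton_add_one (Set.mem_range_self M.start) (Set.toFinite _),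
      ← Nat.card_coe_set_eq, ← Nat.card_eq_fintype_card]
    refine (Nat.card_congr (Equiv.ofBijective
      (fun f => ⟨M.graph.face (M.faceOf_surjective f).choose, _, rfl⟩) ⟨fun f g h => ?_, ?_⟩)).symm
    · have := (hface _ _).1 (Subtype.ext_iff.1 h)
      rwa [(M.faceOf_surjective f).choose_spec, (M.faceOf_surjective g).choose_spec] at this
    · rintro ⟨_, a, rfl⟩
      exact ⟨M.faceOf a, Subtype.ext ((hface _ _).2 (M.faceOf_surjective _).choose_spec)⟩
  have hlabel : ∀ a, ((M.label a).head?).toList = M.label a := by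
    intro a
    have ha := hlab a
    generalize M.label a = l at *
    rcases l with _ | ⟨b, _ | ⟨b', l⟩⟩
    · rfl
    · rfl
    · simp at ha
  let D : PlaneGraph :=
    { V := M.V
      A := M.A
      finite_V := inferInstance
      finite_A := inferInstance
      graph := M.graph
      connected := M.connected
      exterior := M.graph.face M.start
      exterior_face := fun _ => ⟨_, rfl⟩
      euler := by
        rw [hcard, Nat.card_eq_fintype_card, Nat.card_eq_fintype_card]
        exact M.euler }
  let φ : GenMap D.graph.toDartGraph Γ :=
    { onV := M.onV
      onA := fun a => (M.label a).head?
      map_inv := fun a => by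
        have ha := hlabel a
        have := M.label_inv a
        change (M.label (M.graph.inv a)).head? = _
        rw [this]
        rw [← ha]
        cases (M.label a).head? <;> rfl
      map_org := fun a b hab => by
        have := M.isPath_label a
        rw [← hlabel, hab] at this
        exact this.1
      map_collapsed := fun a hab => by
        have := M.isPath_label a
        rwa [← hlabel, hab] at this }
  have hP : ∀ l : List M.A, φ.mapPath l = l.flatMap M.label := by
    intro l
    refine (List.filterMap_eq_flatMap_toList _ l).trans ?_
    exact congrArg (fun f => l.flatMap f) (funext hlabel)
  refine ⟨D, φ, ⟨Or.inl ⟨M.start, M.graph.self_mem_boundary _, hb, ?_⟩, fun a ha => ?_⟩, ?_⟩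
  · rw [hP, ← hw, Diagram.word]
    exact congrArg _ (M.graph.eq_boundary M.run_outer M.nodup_outer M.outer_ne_nil).symm
  · refine le_trans (le_of_eq ?_) (hk (M.faceOf a) fun h => ha ?_)
    · rw [hP]
      refine length_flatMap_eq_sum _ (M.graph.nodup_boundary a) (fun x => M.faceOf x = M.faceOf a)
        fun x => ?_
      rw [M.graph.mem_boundary, M.sameCycle_next, eq_comm]
    · exact M.graph.mem_boundary.2 ((M.sameCycle_next _ _).2 h.symm)
  · change (Set.range M.graph.face \ {M.graph.face M.start}).ncard ≤ n
    omega

theorem Fills.contractible {c : Γ.Loop} (h : Fills Γ k n c.base c.edges) : Γ.Contractible k c := by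
  obtain ⟨D, φ, h, -⟩ := h.exists_isFilling
  exact ⟨D, φ, h⟩

theorem Fills.loopArea_le {c : Γ.Loop} (h : Fills Γ k n c.base c.edges) :
    Γ.loopArea k c ≤ n := by
  obtain ⟨D, φ, h, hn⟩ := h.exists_isFilling
  exact (iInf₂_le_of_le D φ (iInf_le _ h)).trans (by exact_mod_cast hn)

theorem exists_fills_of_loopArea_ne_top {c : Γ.Loop} (h : Γ.loopArea k c ≠ ⊤) :
    ∃ n : ℕ, Γ.loopArea k c = n ∧ Fills Γ k n c.base c.edges := by
  by_contra hcon
  push Not at hcon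
  obtain ⟨n, hn⟩ := ENat.ne_top_iff_exists.1 h
  have hlt : Γ.loopArea k c < (n + 1 : ℕ) := by
    rw [← hn]
    exact_mod_cast n.lt_succ_self
  simp only [DartGraph.loopArea, iInf_lt_iff] at hlt
  obtain ⟨D, φ, hf, hD⟩ := hlt
  have hD' : Γ.loopArea k c = (D.area : ℕ∞) := by
    refine le_antisymm (iInf₂_le_of_le D φ (iInf_le _ hf)) ?_
    rw [← hn]
    have : D.area < n + 1 := by exact_mod_cast hD
    exact_mod_cast Nat.lt_succ_iff.1 this
  exact hcon _ hD' hf.fills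

end Conversion

/-! ### Spectra of quasi-isometric graphs -/

/-- The form in which comparisons of spectra are proved below. -/
theorem preceq_of_le {F G : ℕ → ℕ → ℕ → ℕ∞} {C : ℕ} (hC : 2 ≤ C)
    (h : ∀ k m n : ℕ, 1 ≤ m → C * k ≤ m →
      F k (C * m) n ≤ G (C * k) m (C * n) + (n / m + 2 : ℕ)) :
    Preceq (fun k m n => (F k m n : ℝ≥0∞)) (fun k m n => (G k m n : ℝ≥0∞)) := by
  refine ⟨C, by omega, fun k m n _ hm _ hk => ?_⟩
  have h₁ : (F k (C * m) n : ℝ≥0∞) ≤ G (C * k) m (C * n) + ((n / m : ℕ) + 2) := by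
    have := ENat.toENNReal_mono (h k m n hm hk)
    simpa using this
  have h₂ : ((n / m : ℕ) : ℝ≥0∞) ≤ (n : ℝ≥0∞) / m := by
    rw [ENNReal.le_div_iff_mul_le (Or.inl (by simp; omega)) (Or.inl (by simp))]
    exact_mod_cast Nat.div_mul_le_self n m
  have h₃ : (1 : ℝ≥0∞) ≤ C := by exact_mod_cast (by omega : 1 ≤ C)
  have h₄ : (2 : ℝ≥0∞) ≤ C := by exact_mod_cast hC
  refine h₁.trans ?_
  rw [← add_assoc]
  gcongr
  · exact le_mul_of_one_le_left' h₃
  · exact h₂.trans (le_mul_of_one_le_left' h₃)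

namespace DartGraph

section

variable {V : Type u} {A : Type v} {W : Type u'} {B : Type v'} {Γ : DartGraph V A}
  {Δ : DartGraph W B}

/-- Paths in `Δ` joining the images of the end vertices of the edges of `Γ` can be chosen so that
inverse edges get inverse paths. -/
theorem exists_equivariant_paths (α : V → W) {N : ℕ}
    (h : ∀ a, ∃ l, Δ.IsPath (α (Γ.org a)) l (α (Γ.term a)) ∧ l.length ≤ N) :
    ∃ P : A → List B, (∀ a, Δ.IsPath (α (Γ.org a)) (P a) (α (Γ.term a))) ∧
      (∀ a, P (Γ.inv a) = Δ.rev (P a)) ∧ ∀ a, (P a).length ≤ N := by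
  classical
  choose Q hQ hN using h
  -- A linear order selects one orientation of every edge.
  let _ : LinearOrder A := linearOrderOfSTO WellOrderingRel
  refine ⟨fun a => if a < Γ.inv a then Q a else Δ.rev (Q (Γ.inv a)), fun a => ?_, fun a => ?_,
    fun a => ?_⟩
  · dsimp only
    split_ifs
    · exact hQ a
    · have := (hQ (Γ.inv a)).rev
      rwa [Γ.term_inv] at this
  · dsimp only
    rw [Γ.inv_inv]
    rcases lt_or_gt_of_ne (Γ.inv_ne a) with ha | ha
    · simp [ha, ha.not_gt]
    · simp [ha, ha.not_gt]
  · dsimp only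
    split_ifs
    · exact hN a
    · rw [length_rev]
      exact hN _

/-- Replacing the image of a path under a map close to the identity by the path itself takes one
face for every `m` edges. -/
theorem fills_of_close {γ : V → V} {P : A → List A} {D : V → List A} {N m K : ℕ}
    (hP : ∀ a, Γ.IsPath (γ (Γ.org a)) (P a) (γ (Γ.term a))) (hPN : ∀ a, (P a).length ≤ N)
    (hD : ∀ v, Γ.IsPath (γ v) (D v) v) (hDN : ∀ v, (D v).length ≤ N)
    (hK : 2 * N + N * m + m ≤ K) (s : ℕ) {c z w : List A} {p q r : V} {n : ℕ}
    (hc : Γ.IsPath q c r) (hs : c.length ≤ s * m) (hz : Γ.IsPath p z q)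
    (h : Fills Γ K n p (z ++ (Γ.rev (D q) ++ c.flatMap P ++ w))) :
    Fills Γ K (n + s) p (z ++ (c ++ (Γ.rev (D r) ++ w))) := by
  induction s generalizing c z q n with
  | zero =>
    obtain rfl : c = [] := by simpa using hs
    obtain rfl : q = r := hc
    simpa using h
  | succ s ih =>
    rw [← List.take_append_drop m c] at hc
    obtain ⟨q', hc₁, hc₂⟩ := isPath_append.1 hc
    have hc₁' := hc₁.flatMap γ hP
    have h₁ : (c.take m).length ≤ m := List.length_take_le _ _
    have h₂ : ((c.take m).flatMap P).length ≤ N * m :=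
      (length_flatMap_le hPN _).trans (Nat.mul_le_mul_left _ h₁)
    have h₃ : (c.drop m).length ≤ s * m := by
      rw [List.length_drop]
      rw [add_mul, one_mul] at hs
      omega
    have key : Fills Γ K (n + 1) p
        (z ++ ((c.take m ++ Γ.rev (D q')) ++ ((c.drop m).flatMap P ++ w))) := by
      refine Fills.replace (x := Γ.rev (D q) ++ (c.take m).flatMap P) (r := γ q') ?_ hz
        (isPath_append.2 ⟨_, (hD q).rev, hc₁'⟩) (isPath_append.2 ⟨_, hc₁, (hD q').rev⟩) ?_
      · have hsplit : c.flatMap P = (c.take m).flatMap P ++ (c.drop m).flatMap P := by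
          rw [← List.flatMap_append, List.take_append_drop]
        rw [hsplit] at h
        simpa using h
      · have := hDN q
        have := hDN q'
        simp only [List.length_append, length_rev]
        omega
    have := ih (z := z ++ c.take m) hc₂ h₃ (isPath_append.2 ⟨_, hz, hc₁⟩) (by simpa using key)
    rw [show n + (s + 1) = n + 1 + s by omega, ← List.take_append_drop m c]
    simpa only [List.append_assoc] using this

/-- The spectrum, with values in the extended natural numbers. -/
noncomputable def natSpectrum (Γ : DartGraph V A) (k m n : ℕ) : ℕ∞ :=
  ⨆ (c : Γ.Loop) (_ : Γ.Contractible k c) (_ : c.edges.length ≤ n), Γ.loopArea m c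

/-- The comparison of spectra of graphs, for maps of the vertex sets. -/
theorem natSpectrum_le (α : V → W) (β : W → V) {N : ℕ} (hN : 1 ≤ N)
    (hα : ∀ a, ∃ l, Δ.IsPath (α (Γ.org a)) l (α (Γ.term a)) ∧ l.length ≤ N)
    (hβ : ∀ b, ∃ l, Γ.IsPath (β (Δ.org b)) l (β (Δ.term b)) ∧ l.length ≤ N)
    (hβα : ∀ v, ∃ l, Γ.IsPath (β (α v)) l v ∧ l.length ≤ N) {k m n C : ℕ} (hm : 1 ≤ m)
    (hC : C = 3 * (N * N) + 3 * N + 2) :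
    Γ.natSpectrum k (C * m) n ≤ Δ.natSpectrum (C * k) m (C * n) + (n / m + 2 : ℕ) := by
  obtain ⟨P, hP, hPinv, hPN⟩ := exists_equivariant_paths α hα
  obtain ⟨Q, hQ, hQinv, hQN⟩ := exists_equivariant_paths β hβ
  choose D hD hDN using hβα
  have hNC : N ≤ C := by rw [hC]; nlinarith
  refine iSup_le fun c => iSup_le fun hck => iSup_le fun hcn => ?_
  let c' : Δ.Loop := ⟨α c.base, c.edges.flatMap P, c.isPath.flatMap α hP⟩
  have hc'n : c'.edges.length ≤ C * n :=
    (length_flatMap_le hPN _).trans (Nat.mul_le_mul hNC hcn)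
  have hc'k : Δ.Contractible (C * k) c' := by
    obtain ⟨D, φ, hφ⟩ := hck
    obtain ⟨M, h₁, h₂, h₃, h₄⟩ := hφ.fills.map α hP hPinv hPN
    exact Fills.contractible (n := D.area)
      ⟨M, h₁, h₂, h₃, fun f hf => (h₄ f hf).trans (Nat.mul_le_mul_right k hNC)⟩
  have hle : Δ.loopArea m c' ≤ Δ.natSpectrum (C * k) m (C * n) :=
    le_iSup_of_le c' (le_iSup_of_le hc'k (le_iSup_of_le hc'n le_rfl))
  refine le_trans ?_ (add_le_add_left hle _)
  by_cases htop : Δ.loopArea m c' = ⊤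
  · simp [htop]
  obtain ⟨a, ha, hfill⟩ := exists_fills_of_loopArea_ne_top htop
  rw [ha]
  have hNm : N ≤ N * m := Nat.le_mul_of_pos_right N hm
  have hCm : C * m = 3 * (N * N * m) + 3 * (N * m) + 2 * m := by rw [hC]; ring
  have h₁ : Fills Γ (C * m) a (β (α c.base)) ((c.edges.flatMap P).flatMap Q) := by
    obtain ⟨M, h₁, h₂, h₃, h₄⟩ := hfill.map β hQ hQinv hQN
    exact ⟨M, h₁, h₂, h₃, fun f hf => (h₄ f hf).trans (by nlinarith)⟩
  have h₂ := h₁.conj (hD c.base).rev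
  have hPQ : ∀ a, ((P a).flatMap Q).length ≤ N * N := fun a =>
    (length_flatMap_le hQN _).trans (Nat.mul_le_mul_left _ (hPN a))
  have hs : c.edges.length ≤ (n / m + 1) * m := by
    have := Nat.div_add_mod n m
    have := Nat.mod_lt n hm
    rw [add_mul, one_mul, mul_comm (n / m)]
    omega
  have hNN : N ≤ N * N := Nat.le_mul_of_pos_right N hN
  -- Now `c` is put in place of its image under `β ∘ α`, and finally the detour at the base removed.
  have h₃ := fills_of_close (γ := β ∘ α) (P := fun a => (P a).flatMap Q) (D := D)
    (N := N * N) (K := C * m) (m := m) (n := a)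
    (fun a => (hP a).flatMap β hQ) hPQ hD (fun v => (hDN v).trans hNN)
    (by have := Nat.le_mul_of_pos_right (N * N) hm; rw [hCm]; omega)
    (n / m + 1) c.isPath hs (z := []) (w := D c.base) rfl
    (by simpa [List.flatMap_assoc] using h₂)
  have h₄ : Fills Γ (C * m) (a + (n / m + 1) + 1) c.base (c.edges ++ ([] ++ [])) := by
    refine Fills.replace (x := Γ.rev (D c.base) ++ D c.base) (r := c.base) (by simpa using h₃)
      c.isPath (isPath_append.2 ⟨_, (hD _).rev, hD _⟩) rfl ?_
    have := hDN c.base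
    simp only [List.length_append, length_rev, List.length_nil]
    nlinarith
  have h₅ : Fills Γ (C * m) (a + (n / m + 2)) c.base c.edges := by
    simpa [add_assoc] using h₄
  exact_mod_cast h₅.loopArea_le

theorem exists_isPath_length (hΓ : Γ.Connected) (p q : V) :
    ∃ l, Γ.IsPath p l q ∧ l.length = Γ.vertexDist p q := by
  obtain ⟨l, hl⟩ := hΓ.2 p q
  exact Nat.sInf_mem (s := {n | ∃ l : List A, Γ.IsPath p l q ∧ l.length = n}) ⟨_, l, hl, rfl⟩

theorem vertexDist_le {p q : V} {l : List A} (h : Γ.IsPath p l q) :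
    Γ.vertexDist p q ≤ l.length := Nat.sInf_le ⟨l, h, rfl⟩

theorem vertexDist_triangle (hΓ : Γ.Connected) (p q r : V) :
    Γ.vertexDist p r ≤ Γ.vertexDist p q + Γ.vertexDist q r := by
  obtain ⟨l, hl, hl'⟩ := exists_isPath_length hΓ p q
  obtain ⟨l', hr, hr'⟩ := exists_isPath_length hΓ q r
  rw [← hl', ← hr', ← List.length_append]
  exact vertexDist_le (isPath_append.2 ⟨_, hl, hr⟩)

theorem vertexDist_comm_le (hΓ : Γ.Connected) (p q : V) :
    Γ.vertexDist p q ≤ Γ.vertexDist q p := by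
  obtain ⟨l, hl, hl'⟩ := exists_isPath_length hΓ q p
  rw [← hl', ← Γ.length_rev]
  exact vertexDist_le hl.rev

/-- A vertex at distance at most one from a point. -/
def nearVertex (Γ : DartGraph V A) : Γ.Point → V := Sum.elim id (fun x => Γ.org x.1)

theorem arcLengths_nonneg {x y : Γ.Point} {r : ℝ} (hr : r ∈ Γ.arcLengths x y) : 0 ≤ r := by
  have hex : ∀ (x : Γ.Point), ∀ e ∈ Γ.exits x, 0 ≤ e.2 := by
    rintro (x | ⟨a, t⟩) e he
    · obtain rfl : e = (x, 0) := he
      exact le_rfl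
    · rcases he with rfl | rfl
      · exact t.2.1
      · exact sub_nonneg.2 t.2.2
  rcases hr with (⟨e, he, f, hf, rfl⟩ | ⟨a, s, t, -, -, rfl⟩) | ⟨a, s, t, -, -, rfl⟩
  · have := hex x e he
    have := hex y f hf
    positivity
  · positivity
  · positivity

theorem exits_nearVertex (x : Γ.Point) : ∃ t : ℝ, t ≤ 1 ∧ (Γ.nearVertex x, t) ∈ Γ.exits x := by
  rcases x with x | ⟨a, t⟩
  · exact ⟨0, zero_le_one, rfl⟩
  · exact ⟨t, t.2.2, Or.inl rfl⟩

theorem realDist_nearVertex_le (x : Γ.Point) :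
    Γ.realDist (Sum.inl (Γ.nearVertex x)) x ≤ 1 := by
  obtain ⟨t, ht, hx⟩ := exits_nearVertex x
  refine (csInf_le ⟨0, fun r hr => arcLengths_nonneg hr⟩ ?_).trans ht
  refine Or.inl (Or.inl ⟨_, rfl, _, hx, ?_⟩)
  have : Γ.vertexDist (Γ.nearVertex x) (Γ.nearVertex x) = 0 :=
    Nat.le_zero.1 (vertexDist_le (l := []) rfl)
  simp [this]

theorem realDist_inl_inl_le (p q : V) :
    Γ.realDist (Sum.inl p) (Sum.inl q) ≤ Γ.vertexDist p q := by
  refine csInf_le ⟨0, fun r hr => arcLengths_nonneg hr⟩ (Or.inl (Or.inl ⟨_, rfl, _, rfl, ?_⟩))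
  simp

/-- The distance of the vertices near two points exceeds that of the points by at most two. -/
theorem vertexDist_nearVertex_le (hΓ : Γ.Connected) (x y : Γ.Point) :
    (Γ.vertexDist (Γ.nearVertex x) (Γ.nearVertex y) : ℝ) ≤ Γ.realDist x y + 2 := by
  have h₁ : ∀ a, Γ.vertexDist (Γ.org a) (Γ.term a) ≤ 1 := fun a =>
    vertexDist_le (l := [a]) ⟨rfl, rfl⟩
  have hex : ∀ (x : Γ.Point), ∀ e ∈ Γ.exits x, 0 ≤ e.2 ∧
      Γ.vertexDist (Γ.nearVertex x) e.1 ≤ 1 := by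
    rintro (x | ⟨a, t⟩) e he
    · obtain rfl : e = (x, 0) := he
      exact ⟨le_rfl, (vertexDist_le (l := []) rfl).trans zero_le_one⟩
    · rcases he with rfl | rfl
      · exact ⟨t.2.1, (vertexDist_le (l := []) rfl).trans zero_le_one⟩
      · exact ⟨sub_nonneg.2 t.2.2, h₁ a⟩
  rw [← sub_le_iff_le_add]
  refine le_csInf ?_ fun r hr => ?_
  · obtain ⟨s, -, hs⟩ := exits_nearVertex x
    obtain ⟨t, -, ht⟩ := exits_nearVertex y
    exact ⟨_, Or.inl (Or.inl ⟨_, hs, _, ht, rfl⟩)⟩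
  · rw [sub_le_iff_le_add]
    have hr₀ := arcLengths_nonneg hr
    rcases hr with (⟨e, he, f, hf, rfl⟩ | ⟨a, s, t, rfl, rfl, -⟩) | ⟨a, s, t, rfl, rfl, -⟩
    · obtain ⟨he₀, he₁⟩ := hex x e he
      obtain ⟨hf₀, hf₁⟩ := hex y f hf
      have h₂ := vertexDist_triangle hΓ (Γ.nearVertex x) e.1 (Γ.nearVertex y)
      have h₃ := vertexDist_triangle hΓ e.1 f.1 (Γ.nearVertex y)
      have h₄ := (vertexDist_comm_le hΓ f.1 (Γ.nearVertex y)).trans hf₁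
      have : (Γ.vertexDist (Γ.nearVertex x) (Γ.nearVertex y) : ℝ) ≤
          Γ.vertexDist e.1 f.1 + 2 := by
        exact_mod_cast (by omega : Γ.vertexDist (Γ.nearVertex x) (Γ.nearVertex y) ≤
          Γ.vertexDist e.1 f.1 + 2)
      linarith
    · have : Γ.vertexDist (Γ.org a) (Γ.org a) ≤ 0 := vertexDist_le (l := []) rfl
      have : (Γ.vertexDist (Γ.org a) (Γ.org a) : ℝ) ≤ 0 := by exact_mod_cast this
      change (Γ.vertexDist (Γ.org a) (Γ.org a) : ℝ) ≤ _
      linarith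
    · have : (Γ.vertexDist (Γ.org a) (Γ.term a) : ℝ) ≤ 1 := by exact_mod_cast h₁ a
      change (Γ.vertexDist (Γ.org a) (Γ.term a) : ℝ) ≤ _
      linarith

/-- A coarsely Lipschitz map of realizations induces a map of vertices under which the images of
adjacent vertices are at bounded distance. -/
theorem exists_isPath_nearVertex (hΔ : Δ.Connected) {L : ℝ} (hL : 0 ≤ L)
    {α : Γ.Point → Δ.Point}
    (hα : ∀ x y, Δ.realDist (α x) (α y) ≤ L * Γ.realDist x y + L) {N : ℕ} (hN : 2 * L + 2 ≤ N)
    (a : A) : ∃ l, Δ.IsPath (Δ.nearVertex (α (Sum.inl (Γ.org a)))) l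
      (Δ.nearVertex (α (Sum.inl (Γ.term a)))) ∧ l.length ≤ N := by
  obtain ⟨l, hl, hl'⟩ := exists_isPath_length hΔ (Δ.nearVertex (α (Sum.inl (Γ.org a))))
    (Δ.nearVertex (α (Sum.inl (Γ.term a))))
  refine ⟨l, hl, ?_⟩
  have h₁ : (Γ.vertexDist (Γ.org a) (Γ.term a) : ℝ) ≤ 1 := by
    exact_mod_cast vertexDist_le (l := [a]) ⟨rfl, rfl⟩
  have h₂ := vertexDist_nearVertex_le hΔ (α (Sum.inl (Γ.org a))) (α (Sum.inl (Γ.term a)))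
  have h₃ := hα (Sum.inl (Γ.org a)) (Sum.inl (Γ.term a))
  have h₄ := Γ.realDist_inl_inl_le (Γ.org a) (Γ.term a)
  rw [hl']
  have h₅ : L * Γ.realDist (Sum.inl (Γ.org a)) (Sum.inl (Γ.term a)) ≤ L * 1 :=
    mul_le_mul_of_nonneg_left (h₄.trans h₁) hL
  have : (Δ.vertexDist (Δ.nearVertex (α (Sum.inl (Γ.org a))))
      (Δ.nearVertex (α (Sum.inl (Γ.term a)))) : ℝ) ≤ N := by linarith
  exact_mod_cast this

/-- Coarsely inverse maps of realizations induce coarsely inverse maps of vertices. -/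
theorem exists_isPath_nearVertex_comp (hΓ : Γ.Connected) {L : ℝ} (hL : 0 ≤ L)
    {α : Γ.Point → Δ.Point} {β : Δ.Point → Γ.Point}
    (hβ : ∀ x y, Γ.realDist (β x) (β y) ≤ L * Δ.realDist x y + L)
    (hβα : ∀ x, Γ.realDist (β (α x)) x ≤ L) {N : ℕ} (hN : 3 * L + 4 ≤ N) (v : V) :
    ∃ l, Γ.IsPath (Γ.nearVertex (β (Sum.inl (Δ.nearVertex (α (Sum.inl v)))))) l v ∧
      l.length ≤ N := by
  obtain ⟨l, hl, hl'⟩ := exists_isPath_length hΓ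
    (Γ.nearVertex (β (Sum.inl (Δ.nearVertex (α (Sum.inl v)))))) v
  refine ⟨l, hl, ?_⟩
  rw [hl']
  have h₁ := vertexDist_triangle hΓ (Γ.nearVertex (β (Sum.inl (Δ.nearVertex (α (Sum.inl v))))))
    (Γ.nearVertex (β (α (Sum.inl v)))) v
  have h₂ := vertexDist_nearVertex_le hΓ (β (Sum.inl (Δ.nearVertex (α (Sum.inl v)))))
    (β (α (Sum.inl v)))
  have h₃ := vertexDist_nearVertex_le hΓ (β (α (Sum.inl v))) (Sum.inl v)
  have h₄ := hβα (Sum.inl v)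
  have h₅ := hβ (Sum.inl (Δ.nearVertex (α (Sum.inl v)))) (α (Sum.inl v))
  have h₆ : L * Δ.realDist (Sum.inl (Δ.nearVertex (α (Sum.inl v)))) (α (Sum.inl v)) ≤ L * 1 :=
    mul_le_mul_of_nonneg_left (realDist_nearVertex_le _) hL
  have h₇ : (Γ.vertexDist (Γ.nearVertex (β (Sum.inl (Δ.nearVertex (α (Sum.inl v)))))) v : ℝ) ≤
      Γ.vertexDist (Γ.nearVertex (β (Sum.inl (Δ.nearVertex (α (Sum.inl v))))))
        (Γ.nearVertex (β (α (Sum.inl v)))) + Γ.vertexDist (Γ.nearVertex (β (α (Sum.inl v)))) v := by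
    exact_mod_cast h₁
  have h₈ : (Γ.vertexDist (Γ.nearVertex (β (α (Sum.inl v)))) v : ℝ) ≤
      Γ.realDist (β (α (Sum.inl v))) (Sum.inl v) + 2 := h₃
  have : (Γ.vertexDist (Γ.nearVertex (β (Sum.inl (Δ.nearVertex (α (Sum.inl v)))))) v : ℝ) ≤ N := by
    linarith
  exact_mod_cast this

/-- One half of the invariance of spectra of graphs under quasi-isometries. -/
theorem preceq_spectrum (hΓ : Γ.Connected) (hΔ : Δ.Connected)
    (h : QuasiIsometric Γ.realDist Δ.realDist) : Preceq Γ.spectrum Δ.spectrum := by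
  obtain ⟨L, hL, α, β, hα, hβ, -, hβα⟩ := h
  obtain ⟨N, hN⟩ := exists_nat_ge (3 * L + 4)
  have hN₁ : 1 ≤ N := by
    have : (1 : ℝ) ≤ N := by linarith
    exact_mod_cast this
  exact preceq_of_le (F := Γ.natSpectrum) (G := Δ.natSpectrum) (C := 3 * (N * N) + 3 * N + 2)
    (by omega) fun k m n hm _ => natSpectrum_le (fun v => Δ.nearVertex (α (Sum.inl v)))
      (fun w => Γ.nearVertex (β (Sum.inl w))) hN₁
      (exists_isPath_nearVertex hΔ hL hα (by linarith))
      (exists_isPath_nearVertex hΓ hL hβ (by linarith))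
      (exists_isPath_nearVertex_comp hΓ hL hβ hβα hN) hm rfl

theorem spectrum_anti (Γ : DartGraph V A) {k m m' n : ℕ} (h : m ≤ m') :
    Γ.spectrum k m' n ≤ Γ.spectrum k m n := by
  refine ENat.toENNReal_mono (iSup_mono fun c => iSup_mono fun _ => iSup_mono fun _ => ?_)
  refine le_iInf fun D => le_iInf fun φ => le_iInf fun hf => ?_
  exact iInf₂_le_of_le D φ (iInf_le _ ⟨hf.1, fun a ha => (hf.2 a ha).trans h⟩)

/-- Finiteness at `(k, m, n)` follows from the comparison at `m / C`, as areas decrease in `m`. -/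
theorem exists_spectrum_ne_top (h : Preceq Δ.spectrum Γ.spectrum) (hfin : Finitary Γ.spectrum) :
    ∃ C : ℕ, 1 ≤ C ∧ ∀ k m n : ℕ, 1 ≤ k → 1 ≤ n → C * k ≤ m → Δ.spectrum k m n ≠ ⊤ := by
  obtain ⟨C, hC, h⟩ := h
  refine ⟨C * C, Nat.mul_pos hC hC, fun k m n hk hn hm => ?_⟩
  have hm₁ : C * k ≤ m / C := by
    rw [Nat.le_div_iff_mul_le hC]
    linarith
  have hCk : 1 ≤ C * k := Nat.mul_pos hC hk
  have hle := (Δ.spectrum_anti (k := k) (n := n) (Nat.mul_div_le m C)).trans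
    (h k (m / C) n hk (hCk.trans hm₁) hn hm₁)
  refine ne_top_of_le_ne_top ?_ hle
  have h₁ := hfin (C * k) (m / C) (C * n) hCk (Nat.mul_pos hC hn) hm₁
  have h₂ : ((m / C : ℕ) : ℝ≥0∞) ≠ 0 := by
    have := hCk.trans hm₁
    exact_mod_cast (by omega : m / C ≠ 0)
  finiteness

end

end DartGraph

/-! ### Words and areas in free groups -/

/-- The element `w` of a free group is given by a word of length at most `n`. -/
def LengthLE {X : Type*} (w : FreeGroup X) (n : ℕ) : Prop :=
  ∃ l : List (X × Bool), FreeGroup.mk l = w ∧ l.length ≤ n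

section LengthLE

variable {X : Type*} {v w : FreeGroup X} {m n : ℕ}

theorem LengthLE.mono (h : LengthLE w m) (hmn : m ≤ n) : LengthLE w n := by
  obtain ⟨l, hl, hl'⟩ := h
  exact ⟨l, hl, hl'.trans hmn⟩

theorem lengthLE_one : LengthLE (1 : FreeGroup X) n := ⟨[], rfl, n.zero_le⟩

theorem LengthLE.mul (hv : LengthLE v m) (hw : LengthLE w n) : LengthLE (v * w) (m + n) := by
  obtain ⟨l, rfl, hl⟩ := hv
  obtain ⟨l', rfl, hl'⟩ := hw
  exact ⟨l ++ l', FreeGroup.mul_mk.symm, by rw [List.length_append]; omega⟩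

theorem LengthLE.inv (hw : LengthLE w n) : LengthLE w⁻¹ n := by
  obtain ⟨l, rfl, hl⟩ := hw
  exact ⟨FreeGroup.invRev l, FreeGroup.inv_mk.symm, by rwa [FreeGroup.invRev_length]⟩

end LengthLE

/-- The element `w` is a product of at most `n` conjugates of elements of `S` and their
inverses. -/
def AreaLE {F : Type*} [Group F] (S : Set F) (w : F) (n : ℕ) : Prop :=
  ∃ l : List F, l.prod = w ∧
    (∀ x ∈ l, ∃ f : F, ∃ R ∈ S, x = f⁻¹ * R * f ∨ x = f⁻¹ * R⁻¹ * f) ∧ l.length ≤ n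

section AreaLE

variable {F : Type u} [Group F] {S : Set F} {v w : F} {m n : ℕ}

theorem areaLE_one : AreaLE S 1 n := ⟨[], rfl, by simp, n.zero_le⟩

theorem areaLE_of_mem (h : w ∈ S) : AreaLE S w 1 :=
  ⟨[w], by simp, by simpa using ⟨1, w, h, by simp⟩, le_rfl⟩

theorem AreaLE.mono_set {T : Set F} (h : AreaLE S w n) (hST : S ⊆ T) : AreaLE T w n := by
  obtain ⟨l, hl, hS, hn⟩ := h
  refine ⟨l, hl, fun x hx => ?_, hn⟩
  obtain ⟨f, R, hR, h⟩ := hS x hx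
  exact ⟨f, R, hST hR, h⟩

theorem AreaLE.mul (hv : AreaLE S v m) (hw : AreaLE S w n) : AreaLE S (v * w) (m + n) := by
  obtain ⟨l, rfl, hl, hm⟩ := hv
  obtain ⟨l', rfl, hl', hn⟩ := hw
  refine ⟨l ++ l', List.prod_append, fun x hx => ?_, by rw [List.length_append]; omega⟩
  exact (List.mem_append.1 hx).elim (hl x) (hl' x)

theorem AreaLE.inv (hw : AreaLE S w n) : AreaLE S w⁻¹ n := by
  obtain ⟨l, rfl, hl, hn⟩ := hw
  refine ⟨(l.map (·⁻¹)).reverse, List.prod_inv_reverse l |>.symm, fun x hx => ?_, by simpa using hn⟩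
  simp only [List.mem_reverse, List.mem_map] at hx
  obtain ⟨y, hy, rfl⟩ := hx
  obtain ⟨f, R, hR, rfl | rfl⟩ := hl y hy
  · exact ⟨f, R, hR, Or.inr (by group)⟩
  · exact ⟨f, R, hR, Or.inl (by group)⟩

theorem AreaLE.conj (hw : AreaLE S w n) (g : F) : AreaLE S (g * w * g⁻¹) n := by
  obtain ⟨l, rfl, hl, hn⟩ := hw
  refine ⟨l.map (MulAut.conj g), ?_, fun x hx => ?_, by simpa using hn⟩
  · rw [← map_list_prod, MulAut.conj_apply]
  · obtain ⟨y, hy, rfl⟩ := List.mem_map.1 hx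
    obtain ⟨f, R, hR, rfl | rfl⟩ := hl y hy
    · exact ⟨f * g⁻¹, R, hR, Or.inl (by rw [MulAut.conj_apply]; group)⟩
    · exact ⟨f * g⁻¹, R, hR, Or.inr (by rw [MulAut.conj_apply]; group)⟩

theorem mem_normalClosure_iff : w ∈ Subgroup.normalClosure S ↔ ∃ n, AreaLE S w n := by
  constructor
  · let N : Subgroup F :=
      { carrier := {w | ∃ n, AreaLE S w n}
        one_mem' := ⟨0, areaLE_one⟩
        mul_mem' := fun ⟨m, hm⟩ ⟨n, hn⟩ => ⟨m + n, hm.mul hn⟩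
        inv_mem' := fun ⟨n, hn⟩ => ⟨n, hn.inv⟩ }
    have hN : N.Normal := ⟨fun w ⟨n, hn⟩ g => ⟨n, hn.conj g⟩⟩
    have : Subgroup.normalClosure S ≤ N :=
      Subgroup.normalClosure_le_normal fun w hw => ⟨1, areaLE_of_mem hw⟩
    exact fun h => this h
  · rintro ⟨n, l, rfl, hl, -⟩
    refine list_prod_mem fun x hx => ?_
    obtain ⟨f, R, hR, h⟩ := hl x hx
    have hR' := Subgroup.subset_normalClosure hR
    have hn : (Subgroup.normalClosure S).Normal := inferInstance
    rcases h with rfl | rfl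
    · simpa using hn.conj_mem _ hR' f⁻¹
    · simpa using hn.conj_mem _ (inv_mem hR') f⁻¹

theorem AreaLE.wordArea_le (h : AreaLE S w n) : wordArea S w ≤ n := by
  obtain ⟨l, hl, hS, hn⟩ := h
  exact (iInf₂_le_of_le l hl (iInf_le _ hS)).trans (by exact_mod_cast hn)

theorem exists_areaLE_of_wordArea_ne_top (h : wordArea S w ≠ ⊤) :
    ∃ n : ℕ, wordArea S w = n ∧ AreaLE S w n := by
  obtain ⟨n, hn⟩ := ENat.ne_top_iff_exists.1 h
  refine ⟨n, hn.symm, ?_⟩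
  have hlt : wordArea S w < (n + 1 : ℕ) := by
    rw [← hn]
    exact_mod_cast n.lt_succ_self
  simp only [wordArea, iInf_lt_iff] at hlt
  obtain ⟨l, hl, hS, hlen⟩ := hlt
  exact ⟨l, hl, hS, Nat.lt_succ_iff.1 (by exact_mod_cast hlen)⟩

end AreaLE

theorem mem_relators {G : Type u} [Group G] {X : Set G} {k : ℕ} {r : FreeGroup X} :
    r ∈ relators X k ↔ LengthLE r k ∧ evalHom X r = 1 := by
  constructor
  · rintro ⟨l, hl, hk, he⟩
    exact ⟨⟨l, hl, hk⟩, he⟩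
  · rintro ⟨⟨l, hl, hk⟩, he⟩
    exact ⟨l, hl, hk, he⟩

theorem relators_mono {G : Type u} [Group G] (X : Set G) {k m : ℕ} (h : k ≤ m) :
    relators X k ⊆ relators X m := by
  intro r hr
  rw [mem_relators] at hr ⊢
  exact ⟨hr.1.mono h, hr.2⟩

/-! ### Finiteness of the spectrum of a group -/

section Spectrum

variable {G : Type u} [Group G] (X : Set G)

/-- The spectrum of a group, with values in the extended natural numbers. -/
noncomputable def natGroupSpectrum (k m n : ℕ) : ℕ∞ :=
  ⨆ (w : List (X × Bool)) (_ : w.length ≤ n)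
    (_ : FreeGroup.mk w ∈ Subgroup.normalClosure (relators X k)),
      wordArea (relators X m) (FreeGroup.mk w)

theorem wordArea_le_natGroupSpectrum {k m n : ℕ} {w : FreeGroup X} (hw : LengthLE w n)
    (hk : w ∈ Subgroup.normalClosure (relators X k)) :
    wordArea (relators X m) w ≤ natGroupSpectrum X k m n := by
  obtain ⟨l, rfl, hl⟩ := hw
  exact le_iSup_of_le l (le_iSup_of_le hl (le_iSup_of_le hk le_rfl))

theorem finitary_groupSpectrum (hX : X.Finite) : Finitary (groupSpectrum X) := by
  intro k m n _ _ hkm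
  have := hX.to_subtype
  have hfin : {w : List (X × Bool) | w.length ≤ n}.Finite := List.finite_length_le _ n
  obtain ⟨N, hN⟩ := (hfin.image fun w =>
    (wordArea (relators X m) (FreeGroup.mk w)).toNat).bddAbove
  have hle : natGroupSpectrum X k m n ≤ N := by
    refine iSup_le fun w => iSup_le fun hw => iSup_le fun hk => ?_
    obtain ⟨l, hl⟩ := mem_normalClosure_iff.1
      (Subgroup.normalClosure_mono (relators_mono X hkm) hk)
    have hne : wordArea (relators X m) (FreeGroup.mk w) ≠ ⊤ :=
      ne_top_of_le_ne_top (ENat.natCast_ne_top l) hl.wordArea_le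
    rw [← ENat.natCast_toNat hne]
    exact_mod_cast hN ⟨w, hw, rfl⟩
  change (natGroupSpectrum X k m n : ℝ≥0∞) ≠ ⊤
  exact ENat.toENNReal_ne_top.2 (ne_top_of_le_ne_top (ENat.natCast_ne_top N) hle)

end Spectrum

/-! ### Cocycles -/

section Cocycle

variable {G : Type u} [Group G] {X : Set G} {F : Type*} [Group F]

/-- A map `Φ` associating with a path in the Cayley graph of `G`, starting at `g` and with label
`w`, an element `Φ w g` of `F`, multiplicatively with respect to concatenation. -/
def IsCocycle (X : Set G) (Φ : FreeGroup X → G → F) : Prop :=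
  ∀ v w g, Φ (v * w) g = Φ v g * Φ w (g * evalHom X v)

/-- The action of `G` on functions on `G` by translation. -/
def translation (G : Type u) [Group G] (F : Type*) [Group F] : G →* MulAut (G → F) where
  toFun g :=
    { toFun := fun f h => f (h * g)
      invFun := fun f h => f (h * g⁻¹)
      left_inv := fun f => by simp
      right_inv := fun f => by simp
      map_mul' := fun _ _ => rfl }
  map_one' := by ext f h; simp
  map_mul' g g' := by
    ext f h
    change f (h * (g * g')) = f (h * g * g')
    rw [mul_assoc]

/-- A cocycle can be prescribed on the generators: this is the universal property of the free
group, applied to a semidirect product. -/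
theorem exists_isCocycle (P : G → X → F) :
    ∃ Φ : FreeGroup X → G → F, IsCocycle X Φ ∧ ∀ x g, Φ (FreeGroup.of x) g = P g x := by
  let E : FreeGroup X →* (G → F) ⋊[translation G F] G :=
    FreeGroup.lift fun x => ⟨fun g => P g x, x⟩
  have hE : ∀ w, (E w).right = evalHom X w := by
    intro w
    have : (SemidirectProduct.rightHom).comp E = evalHom X := by
      ext x
      simp [E, evalHom]
    exact DFunLike.congr_fun this w
  refine ⟨fun w => (E w).left, fun v w g => ?_, fun x g => ?_⟩
  · simp only [map_mul, SemidirectProduct.mul_left, Pi.mul_apply, hE]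
    rfl
  · simp [E]

variable {Φ : FreeGroup X → G → F} (hΦ : IsCocycle X Φ)

include hΦ

theorem IsCocycle.map_one (g : G) : Φ 1 g = 1 := by
  have := hΦ 1 1 g
  simpa using this

theorem IsCocycle.map_inv (w : FreeGroup X) (g : G) :
    Φ w⁻¹ g = (Φ w (g * (evalHom X w)⁻¹))⁻¹ := by
  rw [eq_inv_iff_mul_eq_one, ← hΦ.map_one g, ← inv_mul_cancel w, hΦ, _root_.map_inv]

/-- A cocycle whose values on generators describe the map `α` describes it on all words. -/
theorem IsCocycle.map_eq {K : Type*} [Group K] {α : G → K} {ψ : F →* K}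
    (h : ∀ x g, ψ (Φ (FreeGroup.of x) g) = (α g)⁻¹ * α (g * x)) (w : FreeGroup X) (g : G) :
    ψ (Φ w g) = (α g)⁻¹ * α (g * evalHom X w) := by
  induction w using FreeGroup.induction_on generalizing g with
  | C1 => simp [hΦ.map_one]
  | of x => simpa [evalHom] using h x g
  | inv_of x _ =>
    rw [hΦ.map_inv, _root_.map_inv, h]
    simp [evalHom]
  | mul v w hv hw =>
    rw [hΦ, _root_.map_mul, hv, hw, _root_.map_mul]
    simp [mul_assoc]

end Cocycle

/-- The values of a cocycle are bounded by its values on generators. -/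
theorem IsCocycle.lengthLE {G : Type u} [Group G] {X : Set G} {Y : Type*}
    {Φ : FreeGroup X → G → FreeGroup Y} (hΦ : IsCocycle X Φ) {N : ℕ}
    (hN : ∀ x g, LengthLE (Φ (FreeGroup.of x) g) N) {w : FreeGroup X} {n : ℕ}
    (hw : LengthLE w n) (g : G) : LengthLE (Φ w g) (N * n) := by
  obtain ⟨l, rfl, hl⟩ := hw
  refine LengthLE.mono ?_ (Nat.mul_le_mul_left N hl)
  clear hl
  induction l generalizing g with
  | nil =>
    rw [← FreeGroup.one_eq_mk, hΦ.map_one]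
    exact lengthLE_one
  | cons a l ih =>
    obtain ⟨x, b⟩ := a
    rw [← List.singleton_append, ← FreeGroup.mul_mk, hΦ, List.length_append, mul_add]
    refine LengthLE.mul ?_ (ih _)
    rw [List.length_singleton, mul_one]
    cases b with
    | true => exact hN x g
    | false =>
      have : FreeGroup.mk [(x, false)] = (FreeGroup.of x)⁻¹ := rfl
      rw [this, hΦ.map_inv]
      exact (hN x _).inv

section Transfer

variable {G : Type u} [Group G] {X : Set G} {H : Type v} [Group H] {Y : Set H}
  {Φ : FreeGroup X → G → FreeGroup Y} (hΦ : IsCocycle X Φ) {N : ℕ}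
  (hN : ∀ x g, LengthLE (Φ (FreeGroup.of x) g) N)

variable {α : G → H}
  (hα : ∀ w g, evalHom Y (Φ w g) = (α g)⁻¹ * α (g * evalHom X w))

include hΦ hN hα

theorem IsCocycle.mem_relators {k : ℕ} {r : FreeGroup X} (hr : r ∈ relators X k) (g : G) :
    Φ r g ∈ relators Y (N * k) := by
  rw [IsoSpec.mem_relators] at hr ⊢
  exact ⟨hΦ.lengthLE hN hr.1 g, by rw [hα, hr.2]; simp⟩

/-- A cocycle maps products of conjugates of relators to such products. -/
theorem IsCocycle.areaLE {m n : ℕ} {w : FreeGroup X} (hw : AreaLE (relators X m) w n) (g : G) :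
    AreaLE (relators Y (N * m)) (Φ w g) n := by
  obtain ⟨l, rfl, hl, hn⟩ := hw
  have hconj : ∀ f R g, evalHom X R = 1 → Φ (f⁻¹ * R * f) g =
      (Φ f (g * (evalHom X f)⁻¹))⁻¹ * Φ R (g * (evalHom X f)⁻¹) *
        Φ f (g * (evalHom X f)⁻¹) := by
    intro f R g hR
    rw [hΦ, hΦ, hΦ.map_inv]
    simp [hR]
  refine ⟨l.map (Φ · g), ?_, fun x hx => ?_, by simpa using hn⟩
  · clear hn
    induction l with
    | nil => simp [hΦ.map_one]
    | cons x l ih =>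
      have hx : evalHom X x = 1 := by
        obtain ⟨f, R, hR, rfl | rfl⟩ := hl x (by simp) <;>
          simp [(IsoSpec.mem_relators.1 hR).2]
      rw [List.map_cons, List.prod_cons, List.prod_cons, hΦ, hx, mul_one,
        ih fun y hy => hl y (by simp [hy])]
  · obtain ⟨y, hy, rfl⟩ := List.mem_map.1 hx
    obtain ⟨f, R, hR, rfl | rfl⟩ := hl y hy
    · exact ⟨_, _, hΦ.mem_relators hN hα hR _,
        Or.inl (hconj f R g (IsoSpec.mem_relators.1 hR).2)⟩
    · have hR₁ := (IsoSpec.mem_relators.1 hR).2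
      refine ⟨Φ f (g * (evalHom X f)⁻¹), Φ R _, hΦ.mem_relators hN hα hR (g * (evalHom X f)⁻¹),
        Or.inr ?_⟩
      rw [hconj f R⁻¹ g (by simp [hR₁]), hΦ.map_inv R, hR₁, inv_one, mul_one]

end Transfer

/-- If the cocycle `Θ` with values in `F(X)` describes a map close to the identity, then `w` differs
from the corresponding value of `Θ` by one relator for every `m` letters. -/
theorem IsCocycle.areaLE_of_close {G : Type u} [Group G] {X : Set G}
    {Θ : FreeGroup X → G → FreeGroup X} (hΘ : IsCocycle X Θ) {N m K : ℕ}
    (hN : ∀ x g, LengthLE (Θ (FreeGroup.of x) g) N) {γ : G → G}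
    (hγ : ∀ w g, evalHom X (Θ w g) = (γ g)⁻¹ * γ (g * evalHom X w)) {D : G → FreeGroup X}
    (hD : ∀ g, evalHom X (D g) = (γ g)⁻¹ * g) (hDN : ∀ g, LengthLE (D g) N)
    (hK : 2 * N + N * m + m ≤ K) (s : ℕ) {w : FreeGroup X} (hw : LengthLE w (s * m)) (g : G) :
    AreaLE (relators X K) ((D g)⁻¹ * Θ w g * D (g * evalHom X w) * w⁻¹) s := by
  induction s generalizing w g with
  | zero =>
    obtain ⟨l, rfl, hl⟩ := hw
    obtain rfl : l = [] := by simpa using hl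
    rw [← FreeGroup.one_eq_mk, hΘ.map_one]
    simpa using areaLE_one
  | succ s ih =>
    obtain ⟨l, rfl, hl⟩ := hw
    set u := FreeGroup.mk (l.take m)
    set v := FreeGroup.mk (l.drop m)
    have huv : FreeGroup.mk l = u * v := by
      rw [FreeGroup.mul_mk, List.take_append_drop]
    have hu : LengthLE u m := ⟨_, rfl, List.length_take_le _ _⟩
    have hv : LengthLE v (s * m) := by
      refine ⟨_, rfl, ?_⟩
      rw [List.length_drop]
      rw [add_mul, one_mul] at hl
      omega
    -- The quadrilateral between the first piece `u` of the path and its image.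
    have h₁ : (D g)⁻¹ * Θ u g * D (g * evalHom X u) * u⁻¹ ∈ relators X K := by
      rw [IsoSpec.mem_relators]
      constructor
      · refine LengthLE.mono ((((hDN g).inv.mul (hΘ.lengthLE hN hu g)).mul (hDN _)).mul hu.inv) ?_
        omega
      · simp only [_root_.map_mul, _root_.map_inv, hD, hγ]
        group
    have h₂ := (areaLE_of_mem h₁).mul ((ih hv (g * evalHom X u)).conj u)
    rw [huv, hΘ, _root_.map_mul, add_comm s 1, ← mul_assoc g]
    convert h₂ using 1
    group

/-! ### Quasi-isometries of groups -/

section QuasiIsometry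

variable {G : Type u} [Group G] {X : Set G} {H : Type v} [Group H] {Y : Set H}

/-- The comparison of spectra of groups, for maps which are Lipschitz on Cayley graphs. -/
theorem natGroupSpectrum_le (α : G → H) (β : H → G) {N : ℕ} (hN : 1 ≤ N)
    (hα : ∀ g (x : X), ∃ u, evalHom Y u = (α g)⁻¹ * α (g * x) ∧ LengthLE u N)
    (hβ : ∀ h (y : Y), ∃ u, evalHom X u = (β h)⁻¹ * β (h * y) ∧ LengthLE u N)
    (hβα : ∀ g, ∃ u, evalHom X u = (β (α g))⁻¹ * g ∧ LengthLE u N) {k m n C : ℕ} (hm : 1 ≤ m)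
    (hC : C = 3 * (N * N) + 3 * N + 2) :
    natGroupSpectrum X k (C * m) n ≤ natGroupSpectrum Y (C * k) m (C * n) + (n / m + 2 : ℕ) := by
  choose P hP hPN using hα
  choose Q hQ hQN using hβ
  choose D hD hDN using hβα
  obtain ⟨Φ, hΦ, hΦP⟩ := exists_isCocycle (X := X) P
  obtain ⟨Ψ, hΨ, hΨQ⟩ := exists_isCocycle (X := Y) Q
  have hΦN : ∀ x g, LengthLE (Φ (FreeGroup.of x) g) N := fun x g => hΦP x g ▸ hPN g x
  have hΨN : ∀ y h, LengthLE (Ψ (FreeGroup.of y) h) N := fun y h => hΨQ y h ▸ hQN h y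
  have hΦα := hΦ.map_eq (α := α) (ψ := evalHom Y) fun x g => hΦP x g ▸ hP g x
  have hΨβ := hΨ.map_eq (α := β) (ψ := evalHom X) fun y h => hΨQ y h ▸ hQ h y
  have hΘ : IsCocycle X fun w g => Ψ (Φ w g) (α g) := by
    intro v w g
    simp only [hΦ v w g, hΨ _ _ (α g), hΦα, mul_inv_cancel_left]
  have hΘN : ∀ x g, LengthLE (Ψ (Φ (FreeGroup.of x) g) (α g)) (N * N) := fun x g =>
    hΨ.lengthLE hΨN (hΦN x g) _
  have hΘβα : ∀ w g, evalHom X (Ψ (Φ w g) (α g)) = (β (α g))⁻¹ * β (α (g * evalHom X w)) := by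
    intro w g
    rw [hΨβ, hΦα, mul_inv_cancel_left]
  have hNC : N ≤ C := by rw [hC]; nlinarith
  refine iSup_le fun l => iSup_le fun hl => iSup_le fun hk => ?_
  set w := FreeGroup.mk l
  have hw : LengthLE w n := ⟨l, rfl, hl⟩
  have hw₁ : evalHom X w = 1 := by
    have : Subgroup.normalClosure (relators X k) ≤ (evalHom X).ker :=
      Subgroup.normalClosure_le_normal fun r hr => (mem_relators.1 hr).2
    exact this hk
  have hk' : Φ w 1 ∈ Subgroup.normalClosure (relators Y (C * k)) := by
    obtain ⟨a, ha⟩ := mem_normalClosure_iff.1 hk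
    exact mem_normalClosure_iff.2 ⟨a, (hΦ.areaLE hΦN hΦα ha 1).mono_set
      (relators_mono Y (Nat.mul_le_mul_right k hNC))⟩
  have hle := wordArea_le_natGroupSpectrum Y (m := m)
    ((hΦ.lengthLE hΦN hw 1).mono (Nat.mul_le_mul_right n hNC)) hk'
  refine le_trans ?_ (add_le_add_left hle _)
  by_cases htop : wordArea (relators Y m) (Φ w 1) = ⊤
  · simp [htop]
  obtain ⟨a, ha, harea⟩ := exists_areaLE_of_wordArea_ne_top htop
  rw [ha]
  have hCm : C * m = 3 * (N * N * m) + 3 * (N * m) + 2 * m := by rw [hC]; ring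
  have h₁ : AreaLE (relators X (C * m)) (Ψ (Φ w 1) (α 1)) a :=
    (hΨ.areaLE hΨN hΨβ harea _).mono_set (relators_mono X (Nat.mul_le_mul_right m hNC))
  have hs : n ≤ (n / m + 1) * m := by
    have := Nat.div_add_mod n m
    have := Nat.mod_lt n hm
    rw [add_mul, one_mul, mul_comm (n / m)]
    omega
  have h₂ := hΘ.areaLE_of_close (m := m) (K := C * m) hΘN (γ := β ∘ α) hΘβα hD
    (fun g => (hDN g).mono (Nat.le_mul_of_pos_right N hN))
    (by have := Nat.le_mul_of_pos_right (N * N) hm; rw [hCm]; omega) (n / m + 1) (hw.mono hs) 1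
  have h₃ := h₂.inv.mul (h₁.conj (D 1)⁻¹)
  have h₄ : AreaLE (relators X (C * m)) w (n / m + 1 + a) := by
    convert h₃ using 1
    rw [hw₁, mul_one]
    group
  refine h₄.wordArea_le.trans ?_
  exact_mod_cast (by omega : n / m + 1 + a ≤ a + (n / m + 2))

theorem evalHom_surjective (hX : Subgroup.closure X = ⊤) : Function.Surjective (evalHom X) := by
  rw [← MonoidHom.range_eq_top, evalHom, FreeGroup.range_lift_eq_closure, Subtype.range_coe, hX]

theorem exists_lengthLE_wordDist (hX : Subgroup.closure X = ⊤) (g h : G) :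
    ∃ u, evalHom X u = g⁻¹ * h ∧ LengthLE u (wordDist X g h) := by
  classical
  obtain ⟨u, hu⟩ := evalHom_surjective hX (g⁻¹ * h)
  obtain ⟨l, hl, hl'⟩ := Nat.sInf_mem (s := {n | ∃ w : List (X × Bool),
    evalHom X (FreeGroup.mk w) = g⁻¹ * h ∧ w.length = n})
    ⟨_, u.toWord, by rw [FreeGroup.mk_toWord, hu], rfl⟩
  exact ⟨_, hl, l, rfl, hl'.le⟩

theorem wordDist_le {u : FreeGroup X} {g h : G} {n : ℕ} (hu : evalHom X u = g⁻¹ * h)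
    (hn : LengthLE u n) : wordDist X g h ≤ n := by
  obtain ⟨l, rfl, hl⟩ := hn
  exact le_trans (Nat.sInf_le ⟨l, hu, rfl⟩) hl

theorem wordDist_mul_le (g : G) (x : X) : wordDist X g (g * x) ≤ 1 :=
  wordDist_le (u := FreeGroup.of x) (by simp [evalHom]) ⟨[(x, true)], rfl, le_rfl⟩

/-- Word metrics of finite generating sets are bounded by multiples of each other. -/
theorem exists_wordDist_le {X X' : Set G} (hfin : X.Finite) (hX : Subgroup.closure X = ⊤)
    (hX' : Subgroup.closure X' = ⊤) :
    ∃ K : ℕ, ∀ g h, wordDist X' g h ≤ K * wordDist X g h := by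
  have := hfin.to_subtype
  choose P hP hPN using fun x : X => exists_lengthLE_wordDist hX' 1 (x : G)
  obtain ⟨K, hK⟩ := (Set.finite_range fun x : X => wordDist X' 1 (x : G)).bddAbove
  refine ⟨K, fun g h => ?_⟩
  obtain ⟨u, hu, hn⟩ := exists_lengthLE_wordDist hX g h
  have hΦ : IsCocycle X fun w _ => FreeGroup.lift P w := fun v w _ => map_mul _ _ _
  have hlen := hΦ.lengthLE (N := K) (fun x _ => by
    simpa using (hPN x).mono (hK ⟨x, rfl⟩)) hn g
  refine wordDist_le ?_ hlen
  have hcomp : (evalHom X').comp (FreeGroup.lift P) = evalHom X := by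
    ext x
    simpa [evalHom] using hP x
  rw [← hu, ← hcomp]
  rfl

theorem preceq_groupSpectrum_of_quasiIsometric (hX : Subgroup.closure X = ⊤)
    (hY : Subgroup.closure Y = ⊤)
    (h : QuasiIsometric (fun g h => (wordDist X g h : ℝ)) fun g h => (wordDist Y g h : ℝ)) :
    Preceq (groupSpectrum X) (groupSpectrum Y) := by
  obtain ⟨L, hL, α, β, hα, hβ, -, hβα⟩ := h
  obtain ⟨N, hN⟩ := exists_nat_ge (2 * L + 1)
  have hN₁ : 1 ≤ N := by
    have : (1 : ℝ) ≤ N := by linarith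
    exact_mod_cast this
  refine preceq_of_le (F := natGroupSpectrum X) (G := natGroupSpectrum Y)
    (C := 3 * (N * N) + 3 * N + 2) (by omega) fun k m n hm _ =>
      natGroupSpectrum_le α β hN₁ (fun g x => ?_) (fun h y => ?_) (fun g => ?_) hm rfl
  · obtain ⟨u, hu, hn⟩ := exists_lengthLE_wordDist hY (α g) (α (g * x))
    refine ⟨u, hu, hn.mono ?_⟩
    have h₁ : (wordDist X g (g * x) : ℝ) ≤ 1 := by exact_mod_cast wordDist_mul_le g x
    have h₂ := hα g (g * x)
    have h₃ := mul_le_mul_of_nonneg_left h₁ hL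
    exact_mod_cast (by linarith : (wordDist Y (α g) (α (g * x)) : ℝ) ≤ N)
  · obtain ⟨u, hu, hn⟩ := exists_lengthLE_wordDist hX (β h) (β (h * y))
    refine ⟨u, hu, hn.mono ?_⟩
    have h₁ : (wordDist Y h (h * y) : ℝ) ≤ 1 := by exact_mod_cast wordDist_mul_le h y
    have h₂ := hβ h (h * y)
    have h₃ := mul_le_mul_of_nonneg_left h₁ hL
    exact_mod_cast (by linarith : (wordDist X (β h) (β (h * y)) : ℝ) ≤ N)
  · obtain ⟨u, hu, hn⟩ := exists_lengthLE_wordDist hX (β (α g)) g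
    refine ⟨u, hu, hn.mono ?_⟩
    have h₁ := hβα g
    exact_mod_cast (by linarith : (wordDist X (β (α g)) g : ℝ) ≤ N)

/-- Quasi-isometries for some finite generating sets are quasi-isometries for all of them. -/
theorem GroupsQuasiIsometric.quasiIsometric (h : GroupsQuasiIsometric G H) (hXf : X.Finite)
    (hX : Subgroup.closure X = ⊤) (hYf : Y.Finite) (hY : Subgroup.closure Y = ⊤) :
    QuasiIsometric (fun g h => (wordDist X g h : ℝ)) fun g h => (wordDist Y g h : ℝ) := by
  obtain ⟨X₀, Y₀, hX₀f, hX₀, hY₀f, hY₀, L, hL, α, β, hα, hβ, hαβ, hβα⟩ := h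
  obtain ⟨K₁, h₁⟩ := exists_wordDist_le hXf hX hX₀
  obtain ⟨K₂, h₂⟩ := exists_wordDist_le hX₀f hX₀ hX
  obtain ⟨K₃, h₃⟩ := exists_wordDist_le hYf hY hY₀
  obtain ⟨K₄, h₄⟩ := exists_wordDist_le hY₀f hY₀ hY
  set K : ℝ := K₁ + K₂ + K₃ + K₄ + 1 with hK
  have c₁ : (0 : ℝ) ≤ K₁ := Nat.cast_nonneg _
  have c₂ : (0 : ℝ) ≤ K₂ := Nat.cast_nonneg _
  have c₃ : (0 : ℝ) ≤ K₃ := Nat.cast_nonneg _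
  have c₄ : (0 : ℝ) ≤ K₄ := Nat.cast_nonneg _
  have hK₀ : 1 ≤ K := by linarith
  have hKL : K * L ≤ K * K * L := by
    rw [mul_assoc]
    exact mul_le_mul_of_nonneg_left (le_mul_of_one_le_left hL hK₀) (by linarith)
  have lip : ∀ {a a' b b' : ℝ}, 0 ≤ b → a ≤ K * a' → a' ≤ L * b' + L → b' ≤ K * b →
      a ≤ K * K * L * b + K * K * L := by
    intro a a' b b' hb h₁ h₂ h₃
    calc a ≤ K * (L * (K * b) + L) := by
          refine h₁.trans (mul_le_mul_of_nonneg_left (h₂.trans ?_) (by linarith))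
          have := mul_le_mul_of_nonneg_left h₃ hL
          linarith
      _ = K * K * L * b + K * L := by ring
      _ ≤ _ := by linarith
  have up : ∀ {a b : ℕ} {K' : ℕ}, (K' : ℝ) ≤ K → a ≤ K' * b → (a : ℝ) ≤ K * b := by
    intro a b K' hK' hab
    have : (a : ℝ) ≤ K' * b := by exact_mod_cast hab
    exact this.trans (mul_le_mul_of_nonneg_right hK' (Nat.cast_nonneg b))
  have close : ∀ {a a' : ℝ}, a ≤ K * a' → a' ≤ L → a ≤ K * K * L := by
    intro a a' h₁ h₂
    exact h₁.trans ((mul_le_mul_of_nonneg_left h₂ (by linarith)).trans hKL)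
  refine ⟨K * K * L, by positivity, α, β, fun g h => ?_, fun g h => ?_, fun h => ?_, fun g => ?_⟩
  · exact lip (Nat.cast_nonneg _) (up (by linarith : (K₄ : ℝ) ≤ K) (h₄ _ _)) (hα g h)
      (up (by linarith : (K₁ : ℝ) ≤ K) (h₁ _ _))
  · exact lip (Nat.cast_nonneg _) (up (by linarith : (K₂ : ℝ) ≤ K) (h₂ _ _)) (hβ g h)
      (up (by linarith : (K₃ : ℝ) ≤ K) (h₃ _ _))
  · exact close (up (by linarith : (K₄ : ℝ) ≤ K) (h₄ _ _)) (hαβ h)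
  · exact close (up (by linarith : (K₂ : ℝ) ≤ K) (h₂ _ _)) (hβα g)

end QuasiIsometry

theorem QuasiIsometric.symm {S : Type u} {T : Type v} {dS : S → S → ℝ} {dT : T → T → ℝ}
    (h : QuasiIsometric dS dT) : QuasiIsometric dT dS := by
  obtain ⟨L, hL, α, β, h₁, h₂, h₃, h₄⟩ := h
  exact ⟨L, hL, β, α, h₂, h₁, h₄, h₃⟩

theorem GroupsQuasiIsometric.equivalent {G : Type u} {H : Type v} [Group G] [Group H]
    {X : Set G} {Y : Set H} (h : GroupsQuasiIsometric G H) (hXf : X.Finite)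
    (hX : Subgroup.closure X = ⊤) (hYf : Y.Finite) (hY : Subgroup.closure Y = ⊤) :
    Equivalent (groupSpectrum X) (groupSpectrum Y) :=
  have h := h.quasiIsometric hXf hX hYf hY
  ⟨preceq_groupSpectrum_of_quasiIsometric hX hY h,
    preceq_groupSpectrum_of_quasiIsometric hY hX h.symm⟩

theorem GroupsQuasiIsometric.refl {G : Type u} [Group G] {X : Set G} (hXf : X.Finite)
    (hX : Subgroup.closure X = ⊤) : GroupsQuasiIsometric G G := by
  have h : ∀ g : G, wordDist X g g = 0 := fun g =>
    Nat.le_zero.1 (wordDist_le (u := 1) (by simp) lengthLE_one)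
  refine ⟨X, X, hXf, hX, hXf, hX, 1, zero_le_one, id, id, ?_, ?_, ?_, ?_⟩ <;> simp [h]

end IsoSpec

theorem theorem1p1 :
    -- finitely generated groups
    (∀ (G : Type u) (H : Type v) [Group G] [Group H] (X : Set G) (Y : Set H),
      X.Finite → Subgroup.closure X = ⊤ → Y.Finite → Subgroup.closure Y = ⊤ →
      IsoSpec.GroupsQuasiIsometric G H →
      IsoSpec.Finitary (IsoSpec.groupSpectrum X) ∧ IsoSpec.Finitary (IsoSpec.groupSpectrum Y) ∧
        IsoSpec.Equivalent (IsoSpec.groupSpectrum X) (IsoSpec.groupSpectrum Y)) ∧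
    -- independence of the finite generating set
    (∀ (G : Type u) [Group G] (X Y : Set G),
      X.Finite → Subgroup.closure X = ⊤ → Y.Finite → Subgroup.closure Y = ⊤ →
      IsoSpec.Equivalent (IsoSpec.groupSpectrum X) (IsoSpec.groupSpectrum Y)) ∧
    -- connected graphs
    (∀ (V : Type u) (A : Type v) (W : Type u') (B : Type v')
      (Γ : IsoSpec.DartGraph V A) (Δ : IsoSpec.DartGraph W B),
      Γ.Connected → Δ.Connected → IsoSpec.QuasiIsometric Γ.realDist Δ.realDist →
      IsoSpec.Equivalent Γ.spectrum Δ.spectrum ∧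
        (IsoSpec.Finitary Γ.spectrum →
          ∃ C : ℕ, 1 ≤ C ∧ ∀ k m n : ℕ, 1 ≤ k → 1 ≤ n → C * k ≤ m → Δ.spectrum k m n ≠ ⊤)) := by
  refine ⟨fun G H _ _ X Y hXf hX hYf hY h => ?_, fun G _ X Y hXf hX hYf hY => ?_,
    fun V A W B Γ Δ hΓ hΔ h => ?_⟩
  · exact ⟨IsoSpec.finitary_groupSpectrum X hXf, IsoSpec.finitary_groupSpectrum Y hYf,
      h.equivalent hXf hX hYf hY⟩
  · exact (IsoSpec.GroupsQuasiIsometric.refl hXf hX).equivalent hXf hX hYf hY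
  · have h' := IsoSpec.DartGraph.preceq_spectrum hΔ hΓ h.symm
    exact ⟨⟨IsoSpec.DartGraph.preceq_spectrum hΓ hΔ h, h'⟩,
      IsoSpec.DartGraph.exists_spectrum_ne_top h'⟩
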